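/- Let $S^2$ be the unit sphere of three-dimensional Euclidean space, with the spherical distance (the length of the shorter great-circle arc). A set $C\subset S^2$ is convex if it contains no pair of antipodes and contains, with every two points, the shorter great-circle arc joining them; a spherical convex body is a closed convex set with non-empty interior; it is strictly convex if its boundary contains no arc (of positive length). A hemisphere supports $C$ if it contains $C$ and its bounding great circle contains a boundary point of $C$. The thickness of a lune $G\cap H$, where $G,H$ are hemispheres that are different and not opposite, is the distance between the centers of the two semicircles bounding it. For a hemisphere $K$ supporting $C$, $\mathrm{width}_K(C)$ is the minimum thickness of a lune $K\cap K'$ over all hemispheres $K'$ supporting $C$ that are different from $K$ and not opposite to it; the thickness $\Delta(C)$ is the minimum of $\mathrm{width}_K(C)$ over all hemispheres $K$ supporting $C$; and $C$ is of constant width if $\mathrm{width}_K(C)$ is the same for all hemispheres $K$ supporting $C$. A spherical convex body $R$ is reduced if $\Delta(Z)<\Delta(R)$ for every spherical convex body $Z\subset R$ different from $R$. Theorem. Every strictly convex reduced spherical convex body $R\subset S^2$ with $\Delta(R)<\frac{\pi}{2}$ is of constant width. -/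

import Mathlib

namespace Spherical

noncomputable section

/-- The unit sphere `S²` of the three-dimensional Euclidean space, with the subspace topology. -/
abbrev S2 : Type := Metric.sphere (0 : EuclideanSpace ℝ (Fin 3)) 1

/-- Spherical distance: the length of the shorter part of a great circle joining `a` and `b`. -/
def sdist (a b : S2) : ℝ :=
  InnerProductGeometry.angle (a : EuclideanSpace ℝ (Fin 3)) (b : EuclideanSpace ℝ (Fin 3))

/-- The spherical arc `ab` of two points that are not antipodes: the shorter part of the great
circle through `a` and `b`, that is, the points of the sphere in the convex cone spanned by `a`
and `b`. If `a = b` this is `{a}`. -/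
def arc (a b : S2) : Set S2 :=
  {x | ∃ s t : ℝ, 0 ≤ s ∧ 0 ≤ t ∧
    (x : EuclideanSpace ℝ (Fin 3)) =
      s • (a : EuclideanSpace ℝ (Fin 3)) + t • (b : EuclideanSpace ℝ (Fin 3))}

/-- Spherical convexity: no pair of antipodes, and with every two points the arc joining them. -/
def IsConvex (C : Set S2) : Prop :=
  (∀ a ∈ C, -a ∉ C) ∧ ∀ a ∈ C, ∀ b ∈ C, arc a b ⊆ C

/-- A spherical convex body: a closed convex set with non-empty interior. -/
def IsConvexBody (C : Set S2) : Prop :=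
  IsClosed C ∧ IsConvex C ∧ (interior C).Nonempty

/-- There is no (non-degenerate) arc in the boundary. -/
def NoBoundaryArc (C : Set S2) : Prop :=
  ∀ a b : S2, a ≠ b → a ≠ -b → ¬ arc a b ⊆ frontier C

/-- A strictly convex spherical body. -/
def IsStrictlyConvexBody (C : Set S2) : Prop :=
  IsConvexBody C ∧ NoBoundaryArc C

/-- The hemisphere with center `m`. -/
def hemisphere (m : S2) : Set S2 :=
  {x | sdist m x ≤ Real.pi / 2}

/-- The great circle bounding the hemisphere with center `m`. -/
def boundingCircle (m : S2) : Set S2 :=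
  {x | sdist m x = Real.pi / 2}

/-- The hemisphere with center `k` supports `C` (at some boundary point `p` of `C`). Hemispheres
are represented by their centers throughout. -/
def Supports (k : S2) (C : Set S2) : Prop :=
  C ⊆ hemisphere k ∧ ∃ p ∈ frontier C, p ∈ boundingCircle k

/-- For hemispheres `G`, `H` with centers `g`, `h`, different and not opposite: the semicircle `G/H`
that bounds the lune `G ∩ H` and lies in the great circle bounding `G`. -/
def semicircle (g h : S2) : Set S2 :=
  boundingCircle g ∩ hemisphere h

/-- `c` is the center of the semicircle `G/H`: a point of the great circle bounding `G` such that
the semicircle consists of the points of that great circle in distance at most `π/2` from `c`. -/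
def IsSemicircleCenter (c g h : S2) : Prop :=
  c ∈ boundingCircle g ∧ semicircle g h = {x ∈ boundingCircle g | sdist c x ≤ Real.pi / 2}

/-- `t` is the thickness of the lune `G ∩ H`, where the hemispheres `G`, `H` with centers `g`, `h`
are different and not opposite: the distance of the centers of `G/H` and `H/G`. -/
def IsLuneThickness (g h : S2) (t : ℝ) : Prop :=
  g ≠ h ∧ g ≠ -h ∧
    ∃ c d : S2, IsSemicircleCenter c g h ∧ IsSemicircleCenter d h g ∧ t = sdist c d

/-- The width of `C` determined by the supporting hemisphere `K` with center `k`: the least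
thickness of a lune `K ∩ K'` over the hemispheres `K'` supporting `C`. -/
def width (C : Set S2) (k : S2) : ℝ :=
  sInf {t | ∃ k' : S2, Supports k' C ∧ IsLuneThickness k k' t}

/-- The thickness of `C`: the least width of `C` over all its supporting hemispheres. -/
def thickness (C : Set S2) : ℝ :=
  sInf {w | ∃ k : S2, Supports k C ∧ w = width C k}

/-- `C` has constant width: all supporting hemispheres determine the same width. -/
def IsConstantWidth (C : Set S2) : Prop :=
  ∀ k k' : S2, Supports k C → Supports k' C → width C k = width C k'

/-- A reduced spherical body: every convex body properly contained in it is strictly thinner. -/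
def IsReduced (R : Set S2) : Prop :=
  IsConvexBody R ∧ ∀ Z : Set S2, IsConvexBody Z → Z ⊆ R → Z ≠ R → thickness Z < thickness R

end

end Spherical

open scoped RealInnerProductSpace
open Filter Topology

namespace Spherical

/-! Hemispheres containing `R` are encoded by the set `polar R` of their centers. The thickness of a
lune is π minus the distance of the two centers, so the width at `k` is π minus the largest distance
from `k` to a point of the polar (`width_eq`), and the thickness is π minus the diameter of the
polar (`exists_diameter`). Constant width thus means that every supporting center has a partner at
the maximal distance arccos(-c); such a pair is called diametral. As Δ(R) < π/2, c = cos Δ(R) is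
positive.

Three facts carry the proof. Stationarity at a farthest point together with the bipolar theorem
(`mem_posCone_of_polar`) gives d = s x - c k for a diametral pair k, d, where x is a point of `R` on
the circle bounding the hemisphere of k. Strict convexity makes x unique, so partners are unique
(`PolarDiameter.right_unique`). Reducedness supplies diametral centers: cutting a shrinking cap off
`R` at a boundary point y yields polars with pairs too far apart, and a limit of these pairs is a
diametral pair for `R` one of whose centers supports at y (`PolarDiameter.exists_isDiametral`).
Finally, two diametral pairs that fail to cross would be opposite sides of a quadrilateral whose
diagonals are at most as long, and the triangle inequality then forces a common point
(`PolarDiameter.eq_or_eq_of_det3_mul_pos`).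

At a smooth boundary point nothing remains to be done. At a corner x₀ the supporting centers fill an
arc. Its endpoints are limits of diametral centers supporting at nearby points
(`PolarDiameter.exists_isDiametral_of_extreme`). The diametral centers form a closed set, so a
missing center would lie in a gap between two of them, k₁ and k₂. Their partners support `R` at two
points y₁, y₂; a diametral center supporting at a boundary point between these has a partner that
lies in the gap, since the pairs must cross (`PolarDiameter.exists_between`). Hence there is no gap.
-/

/-- The ambient three-dimensional Euclidean space. -/
abbrev E3 : Type := EuclideanSpace ℝ (Fin 3)

/-! ### Inner products and determinants in three-dimensional space -/

theorem inner_eq_coord (x y : E3) : ⟪x, y⟫ = x 0 * y 0 + x 1 * y 1 + x 2 * y 2 := by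
  simp [PiLp.inner_apply, Fin.sum_univ_three, mul_comm]

/-- The determinant of three vectors. -/
def det3 (a b c : E3) : ℝ :=
  a 0 * (b 1 * c 2 - b 2 * c 1) - a 1 * (b 0 * c 2 - b 2 * c 0) + a 2 * (b 0 * c 1 - b 1 * c 0)

/-- The cross product of two vectors. -/
noncomputable def crossE (a b : E3) : E3 :=
  !₂[a 1 * b 2 - a 2 * b 1, a 2 * b 0 - a 0 * b 2, a 0 * b 1 - a 1 * b 0]

theorem inner_crossE (a b u : E3) : ⟪u, crossE a b⟫ = det3 a b u := by
  rw [inner_eq_coord]; simp [crossE, det3]; ring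

/-- Four vectors of a three-dimensional space satisfy Cramer's linear relation. -/
theorem det3_cramer (a b c u : E3) :
    det3 a b c • u = det3 u b c • a + det3 a u c • b + det3 a b u • c := by
  ext i; fin_cases i <;> simp [det3] <;> ring

/-- The Gram determinant identity; for orthonormal `a`, `b` it becomes Parseval with `det3 a b` as
third coordinate. -/
theorem det3_mul_det3 (a b u w : E3) :
    det3 a b u * det3 a b w =
      ⟪a, a⟫ * (⟪b, b⟫ * ⟪u, w⟫ - ⟪b, w⟫ * ⟪u, b⟫) -
      ⟪a, b⟫ * (⟪a, b⟫ * ⟪u, w⟫ - ⟪b, w⟫ * ⟪u, a⟫) +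
      ⟪a, w⟫ * (⟪a, b⟫ * ⟪u, b⟫ - ⟪b, b⟫ * ⟪u, a⟫) := by
  simp only [inner_eq_coord, det3]; ring

theorem inner_self_S2 (x : S2) : ⟪(x : E3), (x : E3)⟫ = 1 := by
  rw [real_inner_self_eq_norm_sq]; simp

/-- Parseval's identity for the orthonormal basis completing two orthonormal vectors. -/
theorem inner_eq_of_orthonormal {a b : S2} (hab : ⟪(a : E3), (b : E3)⟫ = 0) (u w : E3) :
    ⟪u, w⟫ = ⟪u, (a : E3)⟫ * ⟪w, (a : E3)⟫ + ⟪u, (b : E3)⟫ * ⟪w, (b : E3)⟫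
      + det3 a b u * det3 a b w := by
  have := det3_mul_det3 a b u w
  rw [inner_self_S2, inner_self_S2, hab, real_inner_comm w (a : E3), real_inner_comm w (b : E3)]
    at this
  linarith

theorem det3_swap (a b c : E3) : det3 a c b = - det3 a b c := by
  simp only [det3]; ring

theorem norm_S2 (x : S2) : ‖(x : E3)‖ = 1 := by simp

theorem abs_inner_S2_le (x y : S2) : |⟪(x : E3), (y : E3)⟫| ≤ 1 := by
  simpa using abs_real_inner_le_norm (x : E3) (y : E3)

theorem inner_S2_le (x y : S2) : ⟪(x : E3), (y : E3)⟫ ≤ 1 := (abs_le.1 (abs_inner_S2_le x y)).2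

theorem neg_one_le_inner_S2 (x y : S2) : -1 ≤ ⟪(x : E3), (y : E3)⟫ :=
  (abs_le.1 (abs_inner_S2_le x y)).1

theorem eq_of_inner_S2_eq_one {x y : S2} (h : ⟪(x : E3), (y : E3)⟫ = 1) : x = y :=
  Subtype.ext ((inner_eq_one_iff_of_norm_eq_one (norm_S2 x) (norm_S2 y)).1 h)

theorem eq_neg_of_inner_S2_eq_neg_one {x y : S2} (h : ⟪(x : E3), (y : E3)⟫ = -1) : x = -y := by
  apply eq_of_inner_S2_eq_one
  simp [inner_neg_right, h]

theorem sdist_eq_arccos (x y : S2) : sdist x y = Real.arccos ⟪(x : E3), (y : E3)⟫ := by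
  simp [sdist, InnerProductGeometry.angle]

theorem mem_hemisphere {m x : S2} : x ∈ hemisphere m ↔ 0 ≤ ⟪(m : E3), (x : E3)⟫ := by
  simp only [hemisphere, Set.mem_ofPred_eq, sdist_eq_arccos, Real.arccos_le_pi_div_two]

theorem mem_boundingCircle {m x : S2} : x ∈ boundingCircle m ↔ ⟪(m : E3), (x : E3)⟫ = 0 := by
  simp only [boundingCircle, Set.mem_ofPred_eq, sdist_eq_arccos, Real.arccos_eq_pi_div_two]

/-- The unit vector in the direction of a non-zero vector. -/
noncomputable def unit (v : E3) (hv : v ≠ 0) : S2 :=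
  ⟨‖v‖⁻¹ • v, by simp [norm_smul, hv]⟩

theorem unit_coe (v : E3) (hv : v ≠ 0) : (unit v hv : E3) = ‖v‖⁻¹ • v := rfl

theorem norm_smul_unit (v : E3) (hv : v ≠ 0) : ‖v‖ • (unit v hv : E3) = v := by
  rw [unit_coe, smul_smul, mul_inv_cancel₀ (norm_ne_zero_iff.2 hv), one_smul]

theorem inner_unit_left (v : E3) (hv : v ≠ 0) (w : E3) :
    ⟪(unit v hv : E3), w⟫ = ‖v‖⁻¹ * ⟪v, w⟫ := by
  rw [unit_coe, real_inner_smul_left]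

theorem inner_unit_right (v : E3) (hv : v ≠ 0) (w : E3) :
    ⟪w, (unit v hv : E3)⟫ = ‖v‖⁻¹ * ⟪w, v⟫ := by
  rw [unit_coe, real_inner_smul_right]

theorem continuous_inner_S2 (w : E3) : Continuous fun x : S2 => ⟪w, (x : E3)⟫ := by fun_prop

/-! ### The polar of a spherical set -/

/-- The centers of the hemispheres containing a set. -/
def polar (C : Set S2) : Set S2 := {k | ∀ x ∈ C, 0 ≤ ⟪(k : E3), (x : E3)⟫}

theorem isClosed_polar (C : Set S2) : IsClosed (polar C) := by
  have : polar C = ⋂ x ∈ C, {k : S2 | 0 ≤ ⟪(k : E3), (x : E3)⟫} := by ext; simp [polar]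
  rw [this]
  refine isClosed_biInter fun x _ => isClosed_le continuous_const (by fun_prop)

theorem isCompact_polar (C : Set S2) : IsCompact (polar C) := (isClosed_polar C).isCompact

theorem unit_mem_polar {C : Set S2} {v : E3} (hv : v ≠ 0) (h : ∀ x ∈ C, 0 ≤ ⟪v, (x : E3)⟫) :
    unit v hv ∈ polar C := by
  intro x hx
  rw [inner_unit_left]
  have := h x hx
  positivity

/-- A vector nonnegative on a set pairs with an interior point of the set positively. -/
theorem inner_interior_pos {C : Set S2} {v : E3} (hv : v ≠ 0) (h : ∀ x ∈ C, 0 ≤ ⟪v, (x : E3)⟫)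
    {z : S2} (hz : z ∈ interior C) : 0 < ⟪v, (z : E3)⟫ := by
  have hz0 := h z (interior_subset hz)
  refine lt_of_le_of_ne hz0 fun h0 => ?_
  have hne : ∀ t : ℝ, (z : E3) - t • v ≠ 0 := by
    intro t ht
    have h1 : ⟪(z : E3) - t • v, (z : E3)⟫ = 1 := by
      rw [inner_sub_left, real_inner_smul_left, ← h0, inner_self_S2]; ring
    rw [ht, inner_zero_left] at h1
    exact zero_ne_one h1
  -- If `v` vanished at `z`, moving `z` slightly in the direction `-v` would stay in `C` while
  -- making the product negative.
  let f : ℝ → S2 := fun t => unit ((z : E3) - t • v) (hne t)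
  have hf : Continuous f := by
    refine Continuous.subtype_mk ?_ _
    refine Continuous.smul (Continuous.inv₀ (by fun_prop) fun t => norm_ne_zero_iff.2 (hne t))
      (by fun_prop)
  have hf0 : f 0 = z := by
    apply Subtype.ext; simp [f, unit_coe]
  have hmem : f ⁻¹' (interior C) ∈ nhds (0 : ℝ) :=
    (isOpen_interior.preimage hf).mem_nhds (by simpa [hf0] using hz)
  obtain ⟨ε, hε, hball⟩ := Metric.mem_nhds_iff.1 hmem
  have h2 : f (ε / 2) ∈ C := interior_subset (hball (by
    simp [abs_of_pos hε]; linarith))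
  have h3 := h _ h2
  rw [inner_unit_right, inner_sub_right, real_inner_smul_right, ← h0] at h3
  have hvv : 0 < ⟪v, v⟫ := by rw [real_inner_self_eq_norm_sq]; positivity
  have hn : 0 < ‖(z : E3) - (ε / 2) • v‖⁻¹ := inv_pos.2 (norm_pos_iff.2 (hne _))
  have : 0 < (ε / 2) * ⟪v, v⟫ := by positivity
  nlinarith [mul_pos hn this]

theorem S2_ne_zero (x : S2) : (x : E3) ≠ 0 := by
  intro h; have := norm_S2 x; rw [h] at this; simp at this

theorem mem_frontier_of_inner_eq_zero {C : Set S2} {k p : S2} (hk : k ∈ polar C) (hp : p ∈ C)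
    (h : ⟪(k : E3), (p : E3)⟫ = 0) : p ∈ frontier C := by
  refine ⟨subset_closure hp, fun hi => ?_⟩
  have := inner_interior_pos (S2_ne_zero k) hk hi
  linarith

theorem supports_iff {C : Set S2} (hC : IsClosed C) {k : S2} :
    Supports k C ↔ k ∈ polar C ∧ ∃ p ∈ C, ⟪(k : E3), (p : E3)⟫ = 0 := by
  constructor
  · rintro ⟨h, p, hp, hkp⟩
    refine ⟨fun x hx => mem_hemisphere.1 (h hx), p, hC.frontier_subset hp, mem_boundingCircle.1 hkp⟩
  · rintro ⟨h, p, hp, hkp⟩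
    exact ⟨fun x hx => mem_hemisphere.2 (h x hx), p, mem_frontier_of_inner_eq_zero h hp hkp,
      mem_boundingCircle.2 hkp⟩

/-! ### Cones over convex spherical sets and separation -/

/-- Positive multiples of the points of a spherical set. -/
def posCone (C : Set S2) : Set E3 := {v | ∃ t : ℝ, 0 < t ∧ ∃ x ∈ C, v = t • (x : E3)}

theorem S2_mem_posCone {C : Set S2} {x : S2} (h : (x : E3) ∈ posCone C) : x ∈ C := by
  obtain ⟨t, ht, y, hy, hxy⟩ := h
  have h1 := congrArg norm hxy
  rw [norm_smul, norm_S2, norm_S2, Real.norm_of_nonneg ht.le, mul_one] at h1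
  rw [← h1, one_smul] at hxy
  rwa [Subtype.ext hxy]

theorem add_mem_posCone {C : Set S2} (hC : IsConvex C) {a b : S2} (ha : a ∈ C) (hb : b ∈ C)
    {s t : ℝ} (hs : 0 ≤ s) (ht : 0 ≤ t) (hst : 0 < s + t) :
    s • (a : E3) + t • (b : E3) ∈ posCone C := by
  have hne : s • (a : E3) + t • (b : E3) ≠ 0 := by
    intro h0
    have h1 : s • (a : E3) = -(t • (b : E3)) := eq_neg_of_add_eq_zero_left h0
    have h2 := congrArg norm h1
    rw [norm_neg, norm_smul, norm_smul, norm_S2, norm_S2, Real.norm_of_nonneg hs,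
      Real.norm_of_nonneg ht, mul_one, mul_one] at h2
    subst h2
    have hs0 : s ≠ 0 := by intro h; simp [h] at hst
    have h3 : (a : E3) = -(b : E3) := by
      rw [← smul_neg] at h1
      exact smul_right_injective _ hs0 h1
    have h4 : b = -a := by apply Subtype.ext; simp [h3]
    exact hC.1 a ha (h4 ▸ hb)
  refine ⟨‖s • (a : E3) + t • (b : E3)‖, norm_pos_iff.2 hne, unit _ hne, ?_,
    (norm_smul_unit _ hne).symm⟩
  refine hC.2 a ha b hb ⟨‖s • (a : E3) + t • (b : E3)‖⁻¹ * s, ‖s • (a : E3) + t • (b : E3)‖⁻¹ * t,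
    by positivity, by positivity, ?_⟩
  rw [unit_coe, smul_add, smul_smul, smul_smul]

theorem convex_posCone {C : Set S2} (hC : IsConvex C) : Convex ℝ (posCone C) := by
  rintro _ ⟨s, hs, a, ha, rfl⟩ _ ⟨t, ht, b, hb, rfl⟩ p q hp hq hpq
  rw [smul_smul, smul_smul]
  refine add_mem_posCone hC ha hb (by positivity) (by positivity) ?_
  rcases hp.eq_or_lt with rfl | hp
  · have : q = 1 := by linarith
    subst this; simpa using ht
  · positivity

/-- The cone is the projection of a closed set along the compact sphere, hence closed; the apex must
be added. -/
theorem isClosed_insert_zero_posCone {C : Set S2} (hcl : IsClosed C) :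
    IsClosed (insert 0 (posCone C)) := by
  rcases C.eq_empty_or_nonempty with rfl | ⟨x₀, hx₀⟩
  · have : posCone (∅ : Set S2) = ∅ := by ext; simp [posCone]
    rw [this]
    simp
  have : insert 0 (posCone C) =
      Prod.snd '' {p : S2 × E3 | p.1 ∈ C ∧ p.2 = ‖p.2‖ • (p.1 : E3)} := by
    ext v
    constructor
    · rintro (rfl | ⟨t, ht, x, hx, rfl⟩)
      · exact ⟨(x₀, 0), ⟨hx₀, by simp⟩, rfl⟩
      · exact ⟨(x, t • (x : E3)), ⟨hx, by simp [norm_smul, abs_of_pos ht]⟩, rfl⟩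
    · rintro ⟨⟨x, v⟩, ⟨hx, hv⟩, rfl⟩
      rcases eq_or_ne v 0 with h | h
      · exact Or.inl h
      · exact Or.inr ⟨‖v‖, norm_pos_iff.2 h, x, hx, hv⟩
  rw [this]
  refine isClosedMap_snd_of_compactSpace _ (IsClosed.inter ?_ ?_)
  · exact hcl.preimage continuous_fst
  · exact isClosed_eq (by fun_prop) (by fun_prop)

theorem convex_insert_zero_posCone {C : Set S2} (hC : IsConvex C) :
    Convex ℝ (insert 0 (posCone C)) := by
  rintro a ha b hb p q hp hq hpq
  have hsm : ∀ {t : ℝ} {v : E3}, 0 ≤ t → v ∈ posCone C → t • v ∈ insert 0 (posCone C) := by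
    rintro t _ ht ⟨s, hs, x, hx, rfl⟩
    rcases ht.eq_or_lt with rfl | ht
    · left; simp
    · right; exact ⟨t * s, by positivity, x, hx, by rw [smul_smul]⟩
  rcases ha with rfl | ha
  · rcases hb with rfl | hb
    · left; simp
    · simpa using hsm hq hb
  · rcases hb with rfl | hb
    · simpa using hsm hp ha
    · exact Or.inr (convex_posCone hC ha hb hp hq hpq)

/-- The bipolar theorem for convex spherical sets. -/
theorem mem_posCone_of_polar {C : Set S2} (hcl : IsClosed C) (hC : IsConvex C) {w : E3}
    (hw0 : w ≠ 0) (hw : ∀ d ∈ polar C, 0 ≤ ⟪(d : E3), w⟫) : w ∈ posCone C := by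
  by_contra hnot
  have hnot' : w ∉ insert 0 (posCone C) := fun h => h.elim hw0 hnot
  obtain ⟨f, u, hfu, hub⟩ := geometric_hahn_banach_point_closed (convex_insert_zero_posCone hC)
    (isClosed_insert_zero_posCone hcl) hnot'
  have hu0 : u < 0 := by simpa using hub 0 (Set.mem_insert _ _)
  set g := (InnerProductSpace.toDual ℝ E3).symm f with hg
  have hgf : ∀ v, ⟪g, v⟫ = f v := fun v => InnerProductSpace.toDual_symm_apply
  have hgC : ∀ x ∈ C, 0 ≤ ⟪g, (x : E3)⟫ := by
    intro x hx
    rw [hgf]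
    by_contra hneg
    push Not at hneg
    -- Scaling `x` so that `f` takes exactly the value `u` contradicts strict separation.
    have := hub ((u / f x) • (x : E3)) (Or.inr ⟨u / f x, div_pos_of_neg_of_neg hu0 hneg, x, hx, rfl⟩)
    rw [map_smul, smul_eq_mul, div_mul_cancel₀ _ hneg.ne] at this
    exact lt_irrefl _ this
  have hne : g ≠ 0 := by
    intro h
    have := hgf w
    rw [h, inner_zero_left] at this
    linarith
  have h1 := hw _ (unit_mem_polar hne hgC)
  rw [inner_unit_left, hgf] at h1
  have : 0 < ‖g‖⁻¹ := inv_pos.2 (norm_pos_iff.2 hne)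
  nlinarith

/-- Since `-x` is not in `C`, the bipolar theorem gives a center positive at `x`; by compactness
finitely many centers suffice, and their sum works everywhere. -/
theorem exists_inner_pos {C : Set S2} (hcl : IsClosed C) (hC : IsConvex C) :
    ∃ g : E3, ∀ x ∈ C, 0 < ⟪g, (x : E3)⟫ := by
  have hcov : C ⊆ ⋃ d : polar C, {x : S2 | 0 < ⟪((d : S2) : E3), (x : E3)⟫} := by
    intro x hx
    by_contra h
    simp only [Set.mem_iUnion, not_exists, Set.mem_ofPred_eq, not_lt] at h
    have hmem : ((-x : S2) : E3) ∈ posCone C :=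
      mem_posCone_of_polar hcl hC (S2_ne_zero _) fun d hd => by
        simpa using h ⟨d, hd⟩
    exact hC.1 x hx (S2_mem_posCone hmem)
  obtain ⟨T, hT⟩ := hcl.isCompact.elim_finite_subcover _
    (fun d => isOpen_lt continuous_const (continuous_inner_S2 _)) hcov
  refine ⟨∑ d ∈ T, ((d : S2) : E3), fun x hx => ?_⟩
  rw [sum_inner]
  obtain ⟨d, hd, hdx⟩ := Set.mem_iUnion₂.1 (hT hx)
  exact Finset.sum_pos' (fun e _ => e.2 x hx) ⟨d, hd, hdx⟩

/-- A strictly positive functional on a compact set stays positive under a small perturbation. -/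
theorem exists_pos_sub_smul {C : Set S2} (hcl : IsClosed C) {g : E3}
    (hg : ∀ x ∈ C, 0 < ⟪g, (x : E3)⟫) (w : E3) :
    ∃ ε : ℝ, 0 < ε ∧ ∀ x ∈ C, 0 < ⟪g - ε • w, (x : E3)⟫ := by
  rcases C.eq_empty_or_nonempty with rfl | hne
  · exact ⟨1, one_pos, by simp⟩
  obtain ⟨x₀, hx₀, hmin⟩ := hcl.isCompact.exists_isMinOn hne (continuous_inner_S2 g).continuousOn
  have h0 := hg x₀ hx₀
  refine ⟨⟪g, (x₀ : E3)⟫ / (‖w‖ + 1), by positivity, fun x hx => ?_⟩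
  have h1 : ⟪g, (x₀ : E3)⟫ ≤ ⟪g, (x : E3)⟫ := hmin hx
  have h2 : ⟪w, (x : E3)⟫ ≤ ‖w‖ := by simpa using real_inner_le_norm w (x : E3)
  rw [inner_sub_left, real_inner_smul_left]
  have h3 : ⟪g, (x₀ : E3)⟫ / (‖w‖ + 1) * ⟪w, (x : E3)⟫ ≤ ⟪g, (x₀ : E3)⟫ / (‖w‖ + 1) * ‖w‖ := by
    gcongr
  have h4 : ⟪g, (x₀ : E3)⟫ / (‖w‖ + 1) * ‖w‖ < ⟪g, (x₀ : E3)⟫ := by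
    rw [div_mul_eq_mul_div, div_lt_iff₀ (by positivity)]
    nlinarith
  linarith

/-- First-order condition at a point of the polar that is farthest from `k`. -/
theorem polar_stationary {C : Set S2} {k k' : S2} (hk' : k' ∈ polar C)
    (hmin : ∀ d ∈ polar C, ⟪(k' : E3), (k : E3)⟫ ≤ ⟪(d : E3), (k : E3)⟫) {d : S2}
    (hd : d ∈ polar C) :
    0 ≤ ⟪(d : E3), (k : E3) - ⟪(k' : E3), (k : E3)⟫ • (k' : E3)⟫ := by
  set u := ⟪(k' : E3), (k : E3)⟫ with hu
  rw [inner_sub_right, real_inner_smul_right]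
  -- The polar is closed under normalized positive combinations, so `k' + t d` competes with `k'`.
  -- For `u ≥ 0` the choice t = 1 is enough; for `u < 0` the norm needs an upper bound and t must be
  -- small.
  have key : ∀ t : ℝ, 0 < t → u * ‖(k' : E3) + t • (d : E3)‖ ≤ u + t * ⟪(d : E3), (k : E3)⟫ := by
    intro t ht
    have e : u + t * ⟪(d : E3), (k : E3)⟫ = ⟪(k' : E3) + t • (d : E3), (k : E3)⟫ := by
      rw [inner_add_left, real_inner_smul_left]
    rw [e]
    rcases eq_or_ne ((k' : E3) + t • (d : E3)) 0 with h0 | h0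
    · rw [h0]; simp
    · have h1 := hmin _ (unit_mem_polar (C := C) h0 fun x hx => by
        rw [inner_add_left, real_inner_smul_left]
        have := hk' x hx
        have := hd x hx
        positivity)
      rw [inner_unit_left, inv_mul_eq_div, le_div_iff₀ (norm_pos_iff.2 h0)] at h1
      exact h1
  rcases le_or_gt 0 u with h | h
  · have h1 := key 1 one_pos
    have h2 : 1 + ⟪(d : E3), (k' : E3)⟫ ≤ ‖(k' : E3) + (1 : ℝ) • (d : E3)‖ := by
      have := real_inner_le_norm ((k' : E3) + (1 : ℝ) • (d : E3)) (k' : E3)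
      rw [inner_add_left, inner_self_S2, one_smul, norm_S2, mul_one] at this
      rwa [one_smul]
    nlinarith [mul_le_mul_of_nonneg_left h2 h]
  · have h1 : ∀ t : ℝ, 0 < t →
        u * ⟪(d : E3), (k' : E3)⟫ + u * t / 2 ≤ ⟪(d : E3), (k : E3)⟫ := by
      intro t ht
      have h2 := key t ht
      have h3 : ‖(k' : E3) + t • (d : E3)‖ ^ 2 = 1 + 2 * t * ⟪(d : E3), (k' : E3)⟫ + t ^ 2 := by
        rw [norm_add_sq_real, norm_smul, norm_S2, norm_S2, real_inner_smul_right,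
          real_inner_comm, Real.norm_of_nonneg ht.le]; ring
      have h4 : ‖(k' : E3) + t • (d : E3)‖ ≤ 1 + t * ⟪(d : E3), (k' : E3)⟫ + t ^ 2 / 2 := by
        nlinarith [sq_nonneg (‖(k' : E3) + t • (d : E3)‖ - 1)]
      have h5 := mul_le_mul_of_nonpos_left h4 h.le
      have h6 : t * (u * ⟪(d : E3), (k' : E3)⟫ + u * t / 2) ≤ t * ⟪(d : E3), (k : E3)⟫ := by
        nlinarith
      exact le_of_mul_le_mul_left h6 ht
    by_contra hneg
    push Not at hneg
    have h2 := h1 ((⟪(d : E3), (k : E3)⟫ - u * ⟪(d : E3), (k' : E3)⟫) / u)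
      (div_pos_of_neg_of_neg hneg h)
    rw [mul_div_cancel₀ _ h.ne] at h2
    linarith

/-! ### Thickness of lunes -/

theorem exists_inner_eq_zero (x : S2) : ∃ v : S2, ⟪(v : E3), (x : E3)⟫ = 0 := by
  by_cases h : (x : E3) 0 = 0 ∧ (x : E3) 1 = 0
  · refine ⟨unit !₂[1, 0, 0] (fun h0 => by simpa using congrArg (fun v : E3 => v 0) h0), ?_⟩
    rw [inner_unit_left, inner_eq_coord]
    simp [h.1]
  · refine ⟨unit !₂[-(x : E3) 1, (x : E3) 0, 0] (fun h0 => h ?_), ?_⟩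
    · have h1 := congrArg (fun v : E3 => v 0) h0
      have h2 := congrArg (fun v : E3 => v 1) h0
      simp at h1 h2
      exact ⟨h2, h1⟩
    · rw [inner_unit_left, inner_eq_coord]
      simp
      ring_nf
      simp

theorem inner_left_crossE (a b : E3) : ⟪a, crossE a b⟫ = 0 := by
  rw [inner_crossE]; simp only [det3]; ring

theorem inner_right_crossE (a b : E3) : ⟪b, crossE a b⟫ = 0 := by
  rw [inner_crossE]; simp only [det3]; ring

/-- The third vector of the orthonormal basis completing two orthonormal vectors. -/
theorem exists_cross {a b : S2} (hab : ⟪(a : E3), (b : E3)⟫ = 0) :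
    ∃ v : S2, (v : E3) = crossE a b := by
  refine ⟨⟨crossE a b, ?_⟩, rfl⟩
  have h2 : ⟪crossE (a : E3) b, crossE (a : E3) b⟫ =
      ⟪(a : E3), (a : E3)⟫ * ⟪(b : E3), (b : E3)⟫ - ⟪(a : E3), (b : E3)⟫ ^ 2 := by
    simp only [inner_eq_coord, crossE]; simp; ring
  rw [inner_self_S2, inner_self_S2, hab, real_inner_self_eq_norm_sq] at h2
  have h3 : ‖crossE (a : E3) b‖ ^ 2 = 1 := by linarith
  have h4 : ‖crossE (a : E3) b‖ = 1 := (pow_eq_one_iff_of_nonneg (norm_nonneg _) two_ne_zero).1 h3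
  simpa using h4

/-- The center of the semicircle is the normalized component of `h` orthogonal to `g`: testing with
the vector orthogonal to both `g` and `c`, and with its negative, forces `h` into their plane. -/
theorem isSemicircleCenter_iff {c g h : S2} (hgh : g ≠ h) (hgh' : g ≠ -h) :
    IsSemicircleCenter c g h ↔ ⟪(g : E3), (c : E3)⟫ = 0 ∧ 0 < ⟪(h : E3), (c : E3)⟫ ∧
      (h : E3) = ⟪(g : E3), (h : E3)⟫ • (g : E3) + ⟪(h : E3), (c : E3)⟫ • (c : E3) := by
  have hset : semicircle g h = {x ∈ boundingCircle g | sdist c x ≤ Real.pi / 2} ↔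
      ∀ x : S2, ⟪(g : E3), (x : E3)⟫ = 0 →
        (0 ≤ ⟪(h : E3), (x : E3)⟫ ↔ 0 ≤ ⟪(c : E3), (x : E3)⟫) := by
    rw [semicircle, Set.ext_iff]
    refine forall_congr' fun x => ?_
    have e : (sdist c x ≤ Real.pi / 2) ↔ 0 ≤ ⟪(c : E3), (x : E3)⟫ := mem_hemisphere
    rw [Set.mem_inter_iff, mem_boundingCircle, mem_hemisphere, Set.mem_sep_iff,
      mem_boundingCircle, e]
    tauto
  rw [IsSemicircleCenter, mem_boundingCircle, hset]
  constructor
  · rintro ⟨hgc, hx⟩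
    obtain ⟨v, hv⟩ := exists_cross hgc
    have hgv : ⟪(g : E3), (v : E3)⟫ = 0 := by rw [hv, inner_left_crossE]
    have hcv : ⟪(c : E3), (v : E3)⟫ = 0 := by rw [hv, inner_right_crossE]
    have h1 : 0 ≤ ⟪(h : E3), (v : E3)⟫ := (hx v hgv).2 hcv.ge
    have h2 : 0 ≤ ⟪(h : E3), ((-v : S2) : E3)⟫ :=
      (hx (-v) (by simp [hgv])).2 (by simp [hcv])
    have h3 : ⟪(h : E3), (v : E3)⟫ = 0 := by
      have : ((-v : S2) : E3) = -(v : E3) := rfl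
      rw [this, inner_neg_right] at h2
      linarith
    have h4 : det3 g c h = 0 := by rw [← inner_crossE, ← hv, h3]
    have h5 : 0 ≤ ⟪(h : E3), (c : E3)⟫ := (hx c hgc).2 (by rw [inner_self_S2]; norm_num)
    have h6 : (h : E3) = ⟪(g : E3), (h : E3)⟫ • (g : E3) + ⟪(h : E3), (c : E3)⟫ • (c : E3) := by
      apply ext_inner_right ℝ
      intro w
      rw [inner_eq_of_orthonormal hgc, h4, inner_add_left, real_inner_smul_left,
        real_inner_smul_left, real_inner_comm (g : E3) (h : E3), real_inner_comm w (g : E3),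
        real_inner_comm w (c : E3)]
      ring
    refine ⟨hgc, lt_of_le_of_ne h5 fun h0 => ?_, h6⟩
    rw [← h0, zero_smul, add_zero] at h6
    have h7 : ⟪(g : E3), (h : E3)⟫ * ⟪(g : E3), (h : E3)⟫ = 1 := by
      have := inner_self_S2 h
      nth_rw 1 [h6] at this
      rwa [real_inner_smul_left] at this
    rcases mul_self_eq_one_iff.1 h7 with h8 | h8
    · exact hgh (eq_of_inner_S2_eq_one h8)
    · exact hgh' (eq_neg_of_inner_S2_eq_neg_one h8)
  · rintro ⟨hgc, hpos, he⟩
    refine ⟨hgc, fun x hx => ?_⟩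
    have : ⟪(h : E3), (x : E3)⟫ = ⟪(h : E3), (c : E3)⟫ * ⟪(c : E3), (x : E3)⟫ := by
      nth_rw 1 [he]
      rw [inner_add_left, real_inner_smul_left, real_inner_smul_left, hx]; ring
    rw [this, mul_nonneg_iff_of_pos_left hpos]

theorem exists_isSemicircleCenter {g h : S2} (hgh : g ≠ h) (hgh' : g ≠ -h) :
    ∃ c, IsSemicircleCenter c g h := by
  have hne : (h : E3) - ⟪(g : E3), (h : E3)⟫ • (g : E3) ≠ 0 := by
    intro h0
    have h6 := sub_eq_zero.1 h0
    have h7 : ⟪(g : E3), (h : E3)⟫ * ⟪(g : E3), (h : E3)⟫ = 1 := by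
      have := inner_self_S2 h
      nth_rw 1 [h6] at this
      rwa [real_inner_smul_left] at this
    rcases mul_self_eq_one_iff.1 h7 with h8 | h8
    · exact hgh (eq_of_inner_S2_eq_one h8)
    · exact hgh' (eq_neg_of_inner_S2_eq_neg_one h8)
  set v := (h : E3) - ⟪(g : E3), (h : E3)⟫ • (g : E3) with hv
  have hgv : ⟪(g : E3), v⟫ = 0 := by
    rw [hv, inner_sub_right, real_inner_smul_right, inner_self_S2]; ring
  have hhv : ⟪(h : E3), v⟫ = ‖v‖ ^ 2 := by
    rw [← real_inner_self_eq_norm_sq]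
    nth_rw 2 [hv]
    rw [inner_sub_left, real_inner_smul_left, hgv]; ring
  have hn : 0 < ‖v‖ := norm_pos_iff.2 hne
  have hc : ⟪(h : E3), (unit v hne : E3)⟫ = ‖v‖ := by
    rw [inner_unit_right, hhv]; field_simp
  refine ⟨unit v hne, (isSemicircleCenter_iff hgh hgh').2 ⟨?_, ?_, ?_⟩⟩
  · rw [inner_unit_right, hgv, mul_zero]
  · rw [hc]; exact hn
  · rw [hc, norm_smul_unit, hv]; abel

/-- In the plane of `g` and `h` the semicircle centers are `g` and `h` turned by right angles in
opposite senses, so their distance is supplementary to that of `g` and `h`. -/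
theorem isLuneThickness_iff {g h : S2} {t : ℝ} :
    IsLuneThickness g h t ↔
      g ≠ h ∧ g ≠ -h ∧ t = Real.pi - Real.arccos ⟪(g : E3), (h : E3)⟫ := by
  have key : g ≠ h → g ≠ -h → ∀ c d : S2, IsSemicircleCenter c g h → IsSemicircleCenter d h g →
      sdist c d = Real.pi - Real.arccos ⟪(g : E3), (h : E3)⟫ := by
    intro h1 h2 c d hc hd
    rw [isSemicircleCenter_iff h1 h2] at hc
    rw [isSemicircleCenter_iff h1.symm (by rintro rfl; simp at h2)] at hd
    obtain ⟨hgc, hp, hh⟩ := hc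
    obtain ⟨hhd, hq, hg⟩ := hd
    set u := ⟪(g : E3), (h : E3)⟫ with hu
    set s := ⟪(h : E3), (c : E3)⟫ with hs
    set r := ⟪(g : E3), (d : E3)⟫ with hr
    rw [real_inner_comm (g : E3) (h : E3), ← hu] at hg
    have e1 : s ^ 2 = 1 - u ^ 2 := by
      have := inner_self_S2 h
      nth_rw 1 [hh] at this
      rw [inner_add_left, real_inner_smul_left, real_inner_smul_left, ← hu,
        real_inner_comm (h : E3) (c : E3), ← hs] at this
      linarith
    have e2 : r ^ 2 = 1 - u ^ 2 := by
      have := inner_self_S2 g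
      nth_rw 1 [hg] at this
      rw [inner_add_left, real_inner_smul_left, real_inner_smul_left,
        real_inner_comm (g : E3) (h : E3), ← hu,
        real_inner_comm (g : E3) (d : E3), ← hr] at this
      linarith
    have e3 : s = r := by
      have : (s - r) * (s + r) = 0 := by ring_nf; linarith
      rcases mul_eq_zero.1 this with h | h <;> linarith
    have e4 : 0 = u * r + s * ⟪(c : E3), (d : E3)⟫ := by
      have : ⟪(h : E3), (d : E3)⟫ = u * r + s * ⟪(c : E3), (d : E3)⟫ := by
        nth_rw 1 [hh]
        rw [inner_add_left, real_inner_smul_left, real_inner_smul_left]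
      rw [hhd] at this
      exact this
    have e5 : ⟪(c : E3), (d : E3)⟫ = -u := by
      rw [← e3] at e4
      have : s * (⟪(c : E3), (d : E3)⟫ + u) = 0 := by linarith
      rcases mul_eq_zero.1 this with h | h <;> linarith
    rw [sdist_eq_arccos, e5, Real.arccos_neg]
  constructor
  · rintro ⟨h1, h2, c, d, hc, hd, rfl⟩
    exact ⟨h1, h2, key h1 h2 c d hc hd⟩
  · rintro ⟨h1, h2, rfl⟩
    obtain ⟨c, hc⟩ := exists_isSemicircleCenter h1 h2
    obtain ⟨d, hd⟩ := exists_isSemicircleCenter h1.symm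
      (show h ≠ -g by rintro rfl; simp at h2)
    exact ⟨h1, h2, c, d, hc, hd, (key h1 h2 c d hc hd).symm⟩

/-! ### Width and thickness in terms of the polar -/

theorem neg_notMem_polar {C : Set S2} (hC : IsConvexBody C) {k : S2} (hk : k ∈ polar C) :
    -k ∉ polar C := by
  intro hk'
  obtain ⟨z, hz⟩ := hC.2.2
  have h1 := inner_interior_pos (S2_ne_zero k) hk hz
  have h2 := hk' z (interior_subset hz)
  have : ((-k : S2) : E3) = -(k : E3) := rfl
  rw [this, inner_neg_left] at h2
  linarith

theorem sub_inner_smul_ne_zero {k k' : S2} (h : k ≠ k') (h' : k ≠ -k') :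
    (k : E3) - ⟪(k' : E3), (k : E3)⟫ • (k' : E3) ≠ 0 := by
  intro h0
  have h6 := sub_eq_zero.1 h0
  have h7 : ⟪(k' : E3), (k : E3)⟫ * ⟪(k' : E3), (k : E3)⟫ = 1 := by
    have := inner_self_S2 k
    nth_rw 1 [h6] at this
    rwa [real_inner_smul_left] at this
  rw [real_inner_comm] at h7
  rcases mul_self_eq_one_iff.1 h7 with h8 | h8
  · exact h (eq_of_inner_S2_eq_one h8)
  · exact h' (eq_neg_of_inner_S2_eq_neg_one h8)

/-- The direction from a farthest point `k'` of the polar to `k` is a positive multiple of a point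
of the body. -/
theorem sub_inner_smul_mem_posCone {C : Set S2} (hC : IsConvexBody C) {k k' : S2}
    (hk : k ∈ polar C) (hk' : k' ∈ polar C) (hne : k ≠ k')
    (hmin : ∀ d ∈ polar C, ⟪(k' : E3), (k : E3)⟫ ≤ ⟪(d : E3), (k : E3)⟫) :
    (k : E3) - ⟪(k' : E3), (k : E3)⟫ • (k' : E3) ∈ posCone C := by
  refine mem_posCone_of_polar hC.1 hC.2.1 (sub_inner_smul_ne_zero hne fun h => ?_)
    fun d hd => polar_stationary hk' hmin hd
  exact neg_notMem_polar hC hk' (h ▸ hk)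

/-- Lets the infimum defining the width run over all of the polar: a farthest point is automatically
a supporting center. -/
theorem supports_of_farthest {C : Set S2} (hC : IsConvexBody C) {k k' : S2}
    (hk : k ∈ polar C) (hk' : k' ∈ polar C) (hne : k ≠ k')
    (hmin : ∀ d ∈ polar C, ⟪(k' : E3), (k : E3)⟫ ≤ ⟪(d : E3), (k : E3)⟫) : Supports k' C := by
  obtain ⟨t, ht, x, hx, h⟩ := sub_inner_smul_mem_posCone hC hk hk' hne hmin
  refine (supports_iff hC.1).2 ⟨hk', x, hx, ?_⟩
  have h1 := congrArg (fun v => ⟪(k' : E3), v⟫) h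
  simp only [inner_sub_right, real_inner_smul_right, inner_self_S2] at h1
  have h2 : t * ⟪(k' : E3), (x : E3)⟫ = 0 := by linarith
  exact (mul_eq_zero.1 h2).resolve_left ht.ne'

/-- A body lies in an open hemisphere, whose center can be perturbed. This keeps farthest points
distinct from `k`, as lunes require. -/
theorem polar_nontrivial {C : Set S2} (hC : IsConvexBody C) (k : S2) :
    ∃ m ∈ polar C, m ≠ k := by
  obtain ⟨g, hg⟩ := exists_inner_pos hC.1 hC.2.1
  obtain ⟨z, hz⟩ := hC.2.2
  have hg0 : g ≠ 0 := by
    rintro rfl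
    simpa using hg z (interior_subset hz)
  have hm : unit g hg0 ∈ polar C := unit_mem_polar hg0 fun x hx => (hg x hx).le
  by_cases h : unit g hg0 = k
  · obtain ⟨v, hv⟩ := exists_inner_eq_zero (unit g hg0)
    obtain ⟨ε, hε, hpos⟩ := exists_pos_sub_smul hC.1 hg (v : E3)
    rw [inner_unit_right] at hv
    have hgv : ⟪(v : E3), g⟫ = 0 :=
      (mul_eq_zero.1 hv).resolve_left (inv_ne_zero (norm_ne_zero_iff.2 hg0))
    have hne : g - ε • (v : E3) ≠ 0 := by
      intro h0
      have := hpos z (interior_subset hz)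
      rw [h0, inner_zero_left] at this
      exact lt_irrefl _ this
    refine ⟨unit _ hne, unit_mem_polar hne fun x hx => (hpos x hx).le, fun h' => ?_⟩
    have h1 : ⟪(v : E3), (unit _ hne : E3)⟫ = 0 := by
      rw [h', ← h, inner_unit_right, hgv, mul_zero]
    rw [inner_unit_right, inner_sub_right, real_inner_smul_right, hgv, inner_self_S2] at h1
    have := inv_ne_zero (norm_ne_zero_iff.2 hne)
    simp [this, hε.ne'] at h1
  · exact ⟨_, hm, h⟩

theorem exists_farthest {C : Set S2} (hC : IsConvexBody C) (k : S2) :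
    ∃ k' ∈ polar C, k ≠ k' ∧
      ∀ d ∈ polar C, ⟪(k' : E3), (k : E3)⟫ ≤ ⟪(d : E3), (k : E3)⟫ := by
  obtain ⟨m, hm, hmk⟩ := polar_nontrivial hC k
  obtain ⟨k', hk', hmin⟩ := (isCompact_polar C).exists_isMinOn ⟨m, hm⟩
    (f := fun d : S2 => ⟪(d : E3), (k : E3)⟫) (by fun_prop)
  refine ⟨k', hk', ?_, hmin⟩
  rintro rfl
  have h1 : ⟪(k : E3), (k : E3)⟫ ≤ ⟪(m : E3), (k : E3)⟫ := hmin hm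
  rw [inner_self_S2] at h1
  exact hmk (eq_of_inner_S2_eq_one (le_antisymm (inner_S2_le _ _) h1))

theorem width_eq {C : Set S2} (hC : IsConvexBody C) {k k' : S2}
    (hk : k ∈ polar C) (hk' : k' ∈ polar C) (hne : k ≠ k')
    (hmin : ∀ d ∈ polar C, ⟪(k' : E3), (k : E3)⟫ ≤ ⟪(d : E3), (k : E3)⟫) :
    width C k = Real.pi - Real.arccos ⟪(k : E3), (k' : E3)⟫ := by
  refine IsLeast.csInf_eq ⟨⟨k', supports_of_farthest hC hk hk' hne hmin,
    isLuneThickness_iff.2 ⟨hne, ?_, rfl⟩⟩, ?_⟩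
  · rintro rfl
    exact neg_notMem_polar hC hk' hk
  · rintro t ⟨d, hd, ht⟩
    obtain ⟨-, -, rfl⟩ := isLuneThickness_iff.1 ht
    have h1 := hmin d ((supports_iff hC.1).1 hd).1
    rw [real_inner_comm, real_inner_comm (k : E3) (d : E3)] at h1
    have := Real.arccos_le_arccos h1
    linarith

theorem exists_diameter {C : Set S2} (hC : IsConvexBody C) :
    ∃ k ∈ polar C, ∃ k' ∈ polar C,
      (∀ d ∈ polar C, ∀ e ∈ polar C, ⟪(k : E3), (k' : E3)⟫ ≤ ⟪(d : E3), (e : E3)⟫) ∧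
      thickness C = Real.pi - Real.arccos ⟪(k : E3), (k' : E3)⟫ := by
  obtain ⟨m, hm, -⟩ := exists_farthest hC hC.2.2.some
  obtain ⟨⟨k, k'⟩, ⟨hk, hk'⟩, hmin⟩ := ((isCompact_polar C).prod (isCompact_polar C)).exists_isMinOn
    ⟨(m, m), hm, hm⟩ (f := fun p : S2 × S2 => ⟪(p.1 : E3), (p.2 : E3)⟫) (by fun_prop)
  have hmin' : ∀ d ∈ polar C, ∀ e ∈ polar C, ⟪(k : E3), (k' : E3)⟫ ≤ ⟪(d : E3), (e : E3)⟫ :=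
    fun d hd e he => hmin (show (d, e) ∈ polar C ×ˢ polar C from ⟨hd, he⟩)
  have hne : k ≠ k' := by
    rintro rfl
    obtain ⟨d, hd, hdk⟩ := polar_nontrivial hC k
    have h1 := hmin' d hd k hk
    rw [inner_self_S2] at h1
    exact hdk (eq_of_inner_S2_eq_one (le_antisymm (inner_S2_le _ _) h1))
  refine ⟨k, hk, k', hk', hmin', IsLeast.csInf_eq ⟨⟨k, ?_, ?_⟩, ?_⟩⟩
  · exact supports_of_farthest hC hk' hk hne.symm fun d hd => hmin' d hd k' hk'
  · refine (width_eq hC hk hk' hne fun d hd => ?_).symm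
    rw [real_inner_comm]
    rw [real_inner_comm (k : E3) (d : E3)]
    exact hmin' k hk d hd
  · rintro w ⟨d, hd, rfl⟩
    obtain ⟨e, he, hde, hm⟩ := exists_farthest hC d
    have hd' := ((supports_iff hC.1).1 hd).1
    rw [width_eq hC hd' he hde hm]
    have := Real.arccos_le_arccos (hmin' d hd' e he)
    linarith

/-- A body thinner than another one has a polar of larger diameter. -/
theorem exists_inner_lt_of_thickness_lt {C : Set S2} (hC : IsConvexBody C) {u : ℝ}
    (h : thickness C < Real.pi - Real.arccos u) :
    ∃ k ∈ polar C, ∃ k' ∈ polar C, ⟪(k : E3), (k' : E3)⟫ < u := by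
  obtain ⟨k, hk, k', hk', -, ht⟩ := exists_diameter hC
  refine ⟨k, hk, k', hk', ?_⟩
  by_contra hle
  push Not at hle
  have := Real.arccos_le_arccos hle
  linarith

/-! ### Pairs of points of the polar at maximal distance -/

/-- A strictly convex body is supported by a hemisphere in a single point. -/
theorem eq_of_inner_eq_zero {R : Set S2} (hR : IsStrictlyConvexBody R) {d x x' : S2}
    (hd : d ∈ polar R) (hx : x ∈ R) (hx' : x' ∈ R)
    (h : ⟪(d : E3), (x : E3)⟫ = 0) (h' : ⟪(d : E3), (x' : E3)⟫ = 0) : x = x' := by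
  by_contra hne
  refine hR.2 x x' hne (fun hxx => ?_) fun w hw => ?_
  · exact hR.1.2.1.1 x' hx' (hxx ▸ hx)
  · refine mem_frontier_of_inner_eq_zero hd (hR.1.2.1.2 x hx x' hx' hw) ?_
    obtain ⟨s, t, -, -, e⟩ := hw
    rw [e, inner_add_right, real_inner_smul_right, real_inner_smul_right, h, h']
    ring

/-- The polar of `R` has diameter `arccos (-c)`, strictly between `π / 2` and `π`, and `s` is the
sine of the diameter. -/
structure PolarDiameter (R : Set S2) (c s : ℝ) : Prop where
  le : ∀ d ∈ polar R, ∀ e ∈ polar R, -c ≤ ⟪(d : E3), (e : E3)⟫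
  thickness_eq : thickness R = Real.pi - Real.arccos (-c)
  c_pos : 0 < c
  s_pos : 0 < s
  sq_add_sq : c ^ 2 + s ^ 2 = 1

/-- Two points of the polar at the distance `arccos (-c)`. -/
structure IsDiametral (R : Set S2) (c : ℝ) (k d : S2) : Prop where
  left_mem : k ∈ polar R
  right_mem : d ∈ polar R
  inner_eq : ⟪(k : E3), (d : E3)⟫ = -c

theorem IsDiametral.symm {R : Set S2} {c : ℝ} {k d : S2} (h : IsDiametral R c k d) :
    IsDiametral R c d k :=
  ⟨h.right_mem, h.left_mem, by rw [real_inner_comm]; exact h.inner_eq⟩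

/-- Each member of a diametral pair is farthest from the other, so the tangential direction from `k`
to `d` points to a point of the body; `c` and `s` are the coordinates in the plane of the pair. -/
theorem PolarDiameter.exists_normal {R : Set S2} {c s : ℝ} (hδ : PolarDiameter R c s)
    (hR : IsConvexBody R) {k d : S2} (h : IsDiametral R c k d) :
    ∃ x ∈ R, ⟪(k : E3), (x : E3)⟫ = 0 ∧ (d : E3) = s • (x : E3) - c • (k : E3) := by
  have hne : d ≠ k := by
    rintro rfl
    have h1 := h.inner_eq
    rw [inner_self_S2] at h1
    linarith [hδ.c_pos]
  obtain ⟨t, ht, x, hx, e⟩ := sub_inner_smul_mem_posCone hR h.right_mem h.left_mem hne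
    (fun e he => by rw [h.inner_eq]; exact hδ.le e he d h.right_mem)
  rw [h.inner_eq] at e
  have hd : (d : E3) = t • (x : E3) - c • (k : E3) := by rw [← e, neg_smul]; abel
  have h0 : ⟪(k : E3), (x : E3)⟫ = 0 := by
    have h1 := h.inner_eq
    rw [hd, inner_sub_right, real_inner_smul_right, real_inner_smul_right, inner_self_S2] at h1
    have h2 : t * ⟪(k : E3), (x : E3)⟫ = 0 := by linarith
    exact (mul_eq_zero.1 h2).resolve_left ht.ne'
  have hts : t = s := by
    have h1 := inner_self_S2 d
    rw [hd] at h1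
    simp only [inner_sub_left, inner_sub_right, real_inner_smul_left, real_inner_smul_right,
      inner_self_S2, h0, real_inner_comm (k : E3) (x : E3)] at h1
    have h2 : t ^ 2 = s ^ 2 := by nlinarith [hδ.sq_add_sq]
    exact (pow_left_inj₀ ht.le hδ.s_pos.le two_ne_zero).1 h2
  exact ⟨x, hx, h0, hts ▸ hd⟩

theorem PolarDiameter.right_eq {R : Set S2} {c s : ℝ} (hδ : PolarDiameter R c s)
    (hR : IsStrictlyConvexBody R) {k d x : S2} (h : IsDiametral R c k d) (hx : x ∈ R)
    (hkx : ⟪(k : E3), (x : E3)⟫ = 0) : (d : E3) = s • (x : E3) - c • (k : E3) := by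
  obtain ⟨x', hx', h', e⟩ := hδ.exists_normal hR.1 h
  rwa [eq_of_inner_eq_zero hR h.left_mem hx hx' hkx h']

/-! ### Diametral centers obtained from reducedness -/

/-- The part of a body in a hemisphere whose center is positive at an interior point. -/
theorem isConvexBody_inter {R : Set S2} (hR : IsConvexBody R) {q : E3} {z : S2}
    (hz : z ∈ interior R) (hq : 0 < ⟪q, (z : E3)⟫) :
    IsConvexBody {x ∈ R | 0 ≤ ⟪q, (x : E3)⟫} := by
  refine ⟨?_, ⟨fun a ha hna => hR.2.1.1 a ha.1 hna.1, ?_⟩, z, ?_⟩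
  · exact hR.1.inter (isClosed_le continuous_const (continuous_inner_S2 q))
  · rintro a ⟨ha, ha'⟩ b ⟨hb, hb'⟩ w hw
    refine ⟨hR.2.1.2 a ha b hb hw, ?_⟩
    obtain ⟨s, t, hs, ht, e⟩ := hw
    rw [e, inner_add_right, real_inner_smul_right, real_inner_smul_right]
    positivity
  · refine interior_maximal (t := interior R ∩ {x : S2 | 0 < ⟪q, (x : E3)⟫}) ?_ ?_ ⟨hz, hq⟩
    · exact fun x hx => ⟨interior_subset hx.1, le_of_lt hx.2⟩
    · exact isOpen_interior.inter (isOpen_lt continuous_const (continuous_inner_S2 q))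

/-- Every boundary point of a strictly convex reduced body is supported by a hemisphere whose
center belongs to a pair of points of the polar at maximal distance. -/
theorem PolarDiameter.exists_isDiametral {R : Set S2} {c s : ℝ} (hδ : PolarDiameter R c s)
    (hR : IsStrictlyConvexBody R) (hred : IsReduced R) {y d₀ : S2} (hy : y ∈ R)
    (hd₀ : d₀ ∈ polar R) (hdy : ⟪(d₀ : E3), (y : E3)⟫ = 0) :
    ∃ k d : S2, IsDiametral R c k d ∧ ⟪(k : E3), (y : E3)⟫ = 0 := by
  obtain ⟨z, hz⟩ := hR.1.2.2
  have hz0 := inner_interior_pos (S2_ne_zero d₀) hd₀ hz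
  -- The factor `⟪d₀, z⟫ / 2` keeps the interior point `z` strictly inside every truncated body.
  set ε : ℕ → ℝ := fun n => ⟪(d₀ : E3), (z : E3)⟫ * (1 / ((n : ℝ) + 1)) / 2 with hε
  have hεpos : ∀ n, 0 < ε n := fun n => by simp only [hε]; positivity
  have hεlim : Tendsto ε atTop (𝓝 0) := by
    have := (tendsto_one_div_add_atTop_nhds_zero_nat (𝕜 := ℝ)).const_mul ⟪(d₀ : E3), (z : E3)⟫
    simpa [hε] using this.div_const 2
  have hq : ∀ n, 0 < ⟪(d₀ : E3) - ε n • (y : E3), (z : E3)⟫ := by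
    intro n
    rw [inner_sub_left, real_inner_smul_left]
    have h1 : ε n * ⟪(y : E3), (z : E3)⟫ ≤ ε n * 1 :=
      mul_le_mul_of_nonneg_left (inner_S2_le _ _) (hεpos n).le
    have h2 : (1 / ((n : ℝ) + 1)) ≤ 1 := by
      rw [div_le_one (by positivity)]; linarith [(Nat.cast_nonneg n : (0 : ℝ) ≤ n)]
    have h3 : ε n ≤ ⟪(d₀ : E3), (z : E3)⟫ / 2 := by
      simp only [hε]
      have := mul_le_mul_of_nonneg_left h2 hz0.le
      linarith
    linarith
  have hstep : ∀ n, ∃ p : S2 × S2 × S2,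
      (∀ x ∈ R, 0 ≤ ⟪(d₀ : E3) - ε n • (y : E3), (x : E3)⟫ →
        0 ≤ ⟪(p.1 : E3), (x : E3)⟫ ∧ 0 ≤ ⟪(p.2.1 : E3), (x : E3)⟫) ∧
      ⟪(p.1 : E3), (p.2.1 : E3)⟫ < -c ∧ p.2.2 ∈ R ∧ ⟪(p.1 : E3), (p.2.2 : E3)⟫ < 0 := by
    intro n
    have hbody := isConvexBody_inter hR.1 hz (hq n)
    have hlt := hred.2 _ hbody (fun x hx => hx.1) (fun h => by
      have hyZ : y ∈ {x ∈ R | 0 ≤ ⟪(d₀ : E3) - ε n • (y : E3), (x : E3)⟫} := by rw [h]; exact hy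
      have := hyZ.2
      rw [inner_sub_left, real_inner_smul_left, hdy, inner_self_S2] at this
      linarith [hεpos n])
    rw [hδ.thickness_eq] at hlt
    obtain ⟨k, hk, k', hk', hkk⟩ := exists_inner_lt_of_thickness_lt hbody hlt
    by_cases hkR : k ∈ polar R
    · have hkR' : k' ∉ polar R := fun h => absurd (hδ.le k hkR k' h) (not_le.2 hkk)
      simp only [polar, Set.mem_ofPred_eq, not_forall, not_le] at hkR'
      obtain ⟨x, hx, hneg⟩ := hkR'
      exact ⟨(k', k, x), fun w hw hw' => ⟨hk' w ⟨hw, hw'⟩, hk w ⟨hw, hw'⟩⟩,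
        by rw [real_inner_comm]; exact hkk, hx, hneg⟩
    · simp only [polar, Set.mem_ofPred_eq, not_forall, not_le] at hkR
      obtain ⟨x, hx, hneg⟩ := hkR
      exact ⟨(k, k', x), fun w hw hw' => ⟨hk w ⟨hw, hw'⟩, hk' w ⟨hw, hw'⟩⟩, hkk, hx, hneg⟩
  choose p hp₁ hp₂ hp₃ hp₄ using hstep
  obtain ⟨⟨k, k', x⟩, φ, hφ, hlim⟩ := CompactSpace.tendsto_subseq p
  have hεφ : Tendsto (fun n => ε (φ n)) atTop (𝓝 0) := hεlim.comp hφ.tendsto_atTop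
  have hk : Tendsto (fun n => ((p (φ n)).1 : E3)) atTop (𝓝 (k : E3)) :=
    ((continuous_subtype_val.comp continuous_fst).tendsto _).comp hlim
  have hk' : Tendsto (fun n => ((p (φ n)).2.1 : E3)) atTop (𝓝 (k' : E3)) :=
    ((continuous_subtype_val.comp (continuous_fst.comp continuous_snd)).tendsto _).comp hlim
  have hx : Tendsto (fun n => (p (φ n)).2.2) atTop (𝓝 x) :=
    ((continuous_snd.comp continuous_snd).tendsto _).comp hlim
  have hx' : Tendsto (fun n => ((p (φ n)).2.2 : E3)) atTop (𝓝 (x : E3)) :=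
    (continuous_subtype_val.tendsto _).comp hx
  have hpos : ∀ w ∈ R, 0 < ⟪(d₀ : E3), (w : E3)⟫ →
      0 ≤ ⟪(k : E3), (w : E3)⟫ ∧ 0 ≤ ⟪(k' : E3), (w : E3)⟫ := by
    intro w hw hw0
    have h1 : ∀ᶠ n in atTop, 0 ≤ ⟪((p (φ n)).1 : E3), (w : E3)⟫ ∧
        0 ≤ ⟪((p (φ n)).2.1 : E3), (w : E3)⟫ := by
      filter_upwards [hεφ.eventually (gt_mem_nhds hw0)] with n hn
      refine hp₁ _ w hw ?_
      rw [inner_sub_left, real_inner_smul_left]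
      have := mul_le_mul_of_nonneg_left (inner_S2_le y w) (hεpos (φ n)).le
      linarith
    exact ⟨ge_of_tendsto (hk.inner tendsto_const_nhds) (h1.mono fun _ h => h.1),
      ge_of_tendsto (hk'.inner tendsto_const_nhds) (h1.mono fun _ h => h.2)⟩
  -- Points on the circle of `d₀` are reached by tilting them towards `z`; the chosen `t` is small
  -- enough to keep a negative value negative.
  have hpolar : ∀ l : S2, (∀ w ∈ R, 0 < ⟪(d₀ : E3), (w : E3)⟫ → 0 ≤ ⟪(l : E3), (w : E3)⟫) →
      l ∈ polar R := by
    intro l hl w hw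
    by_contra hneg
    push Not at hneg
    rcases (hd₀ w hw).eq_or_lt with h0 | h0
    · set t := -⟪(l : E3), (w : E3)⟫ / 2 with ht
      have htpos : 0 < t := by linarith
      obtain ⟨r, hr, v, hv, e⟩ := add_mem_posCone hR.1.2.1 hw (interior_subset hz) zero_le_one
        htpos.le (by linarith)
      have h1 : ⟪(d₀ : E3), r • (v : E3)⟫ = t * ⟪(d₀ : E3), (z : E3)⟫ := by
        rw [← e, inner_add_right, real_inner_smul_right, real_inner_smul_right, ← h0]; ring
      have h2 : ⟪(l : E3), r • (v : E3)⟫ = ⟪(l : E3), (w : E3)⟫ + t * ⟪(l : E3), (z : E3)⟫ := by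
        rw [← e, inner_add_right, real_inner_smul_right, real_inner_smul_right]; ring
      rw [real_inner_smul_right] at h1 h2
      have h3 : 0 < ⟪(d₀ : E3), (v : E3)⟫ := by
        have : 0 < r * ⟪(d₀ : E3), (v : E3)⟫ := by rw [h1]; positivity
        exact (mul_pos_iff_of_pos_left hr).1 this
      have h4 := mul_nonneg hr.le (hl v hv h3)
      have h5 := mul_le_mul_of_nonneg_left (inner_S2_le l z) htpos.le
      linarith
    · exact absurd (hl w hw h0) (not_le.2 hneg)
  have hkR : k ∈ polar R := hpolar k fun w hw h => (hpos w hw h).1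
  have hkR' : k' ∈ polar R := hpolar k' fun w hw h => (hpos w hw h).2
  have hxR : x ∈ R := hR.1.1.mem_of_tendsto hx (Eventually.of_forall fun n => hp₃ _)
  -- The point where the first center is negative must lie in the removed cap, so it converges to
  -- `y`.
  have hd₀x : ⟪(d₀ : E3), (x : E3)⟫ ≤ 0 := by
    refine le_of_tendsto_of_tendsto' (tendsto_const_nhds.inner hx') hεφ fun n => ?_
    by_contra hlt
    push Not at hlt
    have := (hp₁ (φ n) _ (hp₃ (φ n)) (by
      rw [inner_sub_left, real_inner_smul_left]
      have := mul_le_mul_of_nonneg_left (inner_S2_le y (p (φ n)).2.2) (hεpos (φ n)).le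
      linarith)).1
    linarith [hp₄ (φ n)]
  have hxy : x = y := eq_of_inner_eq_zero hR hd₀ hxR hy (le_antisymm hd₀x (hd₀ x hxR)) hdy
  have hkx : ⟪(k : E3), (x : E3)⟫ ≤ 0 :=
    le_of_tendsto' (hk.inner hx') fun n => (hp₄ _).le
  have hkk : ⟪(k : E3), (k' : E3)⟫ ≤ -c := le_of_tendsto' (hk.inner hk') fun n => (hp₂ _).le
  exact ⟨k, k', ⟨hkR, hkR', le_antisymm hkk (hδ.le k hkR k' hkR')⟩,
    hxy ▸ le_antisymm hkx (hkR x hxR)⟩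

/-- Centers belonging to a pair of points of the polar at maximal distance form a closed set. -/
theorem isClosed_isDiametral (R : Set S2) (c : ℝ) : IsClosed {k | ∃ d, IsDiametral R c k d} := by
  have : {k | ∃ d, IsDiametral R c k d} = Prod.fst '' {p : S2 × S2 | p.1 ∈ polar R ∧
      p.2 ∈ polar R ∧ ⟪(p.1 : E3), (p.2 : E3)⟫ = -c} := by
    ext k
    constructor
    · rintro ⟨d, h1, h2, h3⟩
      exact ⟨(k, d), ⟨h1, h2, h3⟩, rfl⟩
    · rintro ⟨⟨k, d⟩, ⟨h1, h2, h3⟩, rfl⟩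
      exact ⟨d, h1, h2, h3⟩
  rw [this]
  refine isClosedMap_fst_of_compactSpace _ (IsClosed.inter ?_ (IsClosed.inter ?_ ?_))
  · exact (isClosed_polar R).preimage continuous_fst
  · exact (isClosed_polar R).preimage continuous_snd
  · exact isClosed_eq (by fun_prop) continuous_const

/-- A linear form negative at some point of the body is negative at some boundary point. -/
theorem exists_boundary_inner_neg {R : Set S2} (hR : IsConvexBody R) {q : E3} {x₀ : S2}
    (hx₀ : x₀ ∈ R) (hq₀ : 0 ≤ ⟪q, (x₀ : E3)⟫) {w : S2} (hw : w ∈ R) (hqw : ⟪q, (w : E3)⟫ < 0) :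
    ∃ x ∈ R, ⟪q, (x : E3)⟫ < 0 ∧ ∃ d ∈ polar R, ⟪(d : E3), (x : E3)⟫ = 0 := by
  obtain ⟨g, hg⟩ := exists_inner_pos hR.1 hR.2.1
  -- Minimizing the quotient by the positive form `g` yields a value `l` such that `q - l g`
  -- supports the body at the minimizer.
  obtain ⟨x, hx, hmin⟩ := hR.1.isCompact.exists_isMinOn ⟨w, hw⟩
    (f := fun x : S2 => ⟪q, (x : E3)⟫ / ⟪g, (x : E3)⟫)
    (ContinuousOn.div (by fun_prop) (by fun_prop) fun x hx => (hg x hx).ne')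
  set l := ⟪q, (x : E3)⟫ / ⟪g, (x : E3)⟫ with hl
  have hl0 : l < 0 := lt_of_le_of_lt (hmin hw) (div_neg_of_neg_of_pos hqw (hg w hw))
  have hqx : ⟪q, (x : E3)⟫ = l * ⟪g, (x : E3)⟫ := by rw [hl, div_mul_cancel₀ _ (hg x hx).ne']
  have hne : q - l • g ≠ 0 := by
    intro h0
    rw [sub_eq_zero.1 h0, real_inner_smul_left] at hq₀
    nlinarith [hg x₀ hx₀]
  refine ⟨x, hx, ?_, unit _ hne, unit_mem_polar hne fun v hv => ?_, ?_⟩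
  · rw [hqx]; exact mul_neg_of_neg_of_pos hl0 (hg x hx)
  · have h1 : l ≤ ⟪q, (v : E3)⟫ / ⟪g, (v : E3)⟫ := hmin hv
    rw [le_div_iff₀ (hg v hv)] at h1
    rw [inner_sub_left, real_inner_smul_left]
    linarith
  · rw [inner_unit_left, inner_sub_left, real_inner_smul_left, hqx, sub_self, mul_zero]

/-- The endpoints of the arc of the centers of hemispheres supporting a strictly convex reduced
body at a given point belong to pairs at maximal distance. -/
theorem PolarDiameter.exists_isDiametral_of_extreme {R : Set S2} {c s : ℝ}
    (hδ : PolarDiameter R c s) (hR : IsStrictlyConvexBody R) (hred : IsReduced R) {x₀ b v : S2}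
    (hx₀ : x₀ ∈ R) (hb : b ∈ polar R) (hbx : ⟪(b : E3), (x₀ : E3)⟫ = 0)
    (hv : (v : E3) = crossE b x₀ ∨ (v : E3) = -crossE b x₀)
    (hext : ∀ k ∈ polar R, ⟪(k : E3), (x₀ : E3)⟫ = 0 → ⟪(k : E3), (v : E3)⟫ ≤ 0) :
    ∃ d, IsDiametral R c b d := by
  have hbv : ⟪(b : E3), (v : E3)⟫ = 0 := by
    rcases hv with hv | hv <;> rw [hv] <;> simp [inner_left_crossE]
  have hxv : ⟪(x₀ : E3), (v : E3)⟫ = 0 := by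
    rcases hv with hv | hv <;> rw [hv] <;> simp [inner_right_crossE]
  have hpars : ∀ u w : E3, ⟪u, w⟫ = ⟪u, (b : E3)⟫ * ⟪w, (b : E3)⟫
      + ⟪u, (x₀ : E3)⟫ * ⟪w, (x₀ : E3)⟫ + ⟪u, (v : E3)⟫ * ⟪w, (v : E3)⟫ := by
    intro u w
    rw [inner_eq_of_orthonormal hbx u w]
    rcases hv with hv | hv
    · rw [hv, inner_crossE, inner_crossE]
    · rw [hv, inner_neg_right, inner_neg_right, inner_crossE, inner_crossE]; ring
  set ε : ℕ → ℝ := fun n => 1 / ((n : ℝ) + 1) with hε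
  have hεpos : ∀ n, 0 < ε n := fun n => by simp only [hε]; positivity
  have hεlim : Tendsto ε atTop (𝓝 0) := tendsto_one_div_add_atTop_nhds_zero_nat
  have hstep : ∀ n, ∃ p : S2 × S2, p.1 ∈ R ∧ ⟪(b : E3) + ε n • (v : E3), (p.1 : E3)⟫ < 0 ∧
      (∃ d, IsDiametral R c p.2 d) ∧ ⟪(p.2 : E3), (p.1 : E3)⟫ = 0 := by
    intro n
    set q := (b : E3) + ε n • (v : E3) with hq
    have hqv : ⟪q, (v : E3)⟫ = ε n := by
      rw [hq, inner_add_left, real_inner_smul_left, hbv, inner_self_S2]; ring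
    have hqx : ⟪q, (x₀ : E3)⟫ = 0 := by
      rw [hq, inner_add_left, real_inner_smul_left, hbx, real_inner_comm, hxv]; ring
    have hne : q ≠ 0 := by
      intro h0
      rw [h0, inner_zero_left] at hqv
      exact (hεpos n).ne hqv
    obtain ⟨w, hw, hqw⟩ : ∃ w ∈ R, ⟪q, (w : E3)⟫ < 0 := by
      by_contra hcon
      -- Otherwise the normalized `q` would be a supporting center at `x₀` beyond the endpoint `b`.
      push Not at hcon
      have h1 := hext _ (unit_mem_polar hne hcon) (by rw [inner_unit_left, hqx, mul_zero])
      rw [inner_unit_left, hqv] at h1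
      have : 0 < ‖q‖⁻¹ * ε n := mul_pos (inv_pos.2 (norm_pos_iff.2 hne)) (hεpos n)
      linarith
    obtain ⟨x, hx, hqx', d, hd, hdx⟩ := exists_boundary_inner_neg hR.1 hx₀ hqx.ge hw hqw
    obtain ⟨k, d', hkd, hkx⟩ := hδ.exists_isDiametral hR hred hx hd hdx
    exact ⟨(x, k), hx, hqx', ⟨d', hkd⟩, hkx⟩
  choose p hp₁ hp₂ hp₃ hp₄ using hstep
  obtain ⟨⟨x, k⟩, φ, hφ, hlim⟩ := CompactSpace.tendsto_subseq p
  have hεφ : Tendsto (fun n => ε (φ n)) atTop (𝓝 0) := hεlim.comp hφ.tendsto_atTop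
  have hx : Tendsto (fun n => (p (φ n)).1) atTop (𝓝 x) := (continuous_fst.tendsto _).comp hlim
  have hk : Tendsto (fun n => (p (φ n)).2) atTop (𝓝 k) := (continuous_snd.tendsto _).comp hlim
  have hx' : Tendsto (fun n => ((p (φ n)).1 : E3)) atTop (𝓝 (x : E3)) :=
    (continuous_subtype_val.tendsto _).comp hx
  have hk' : Tendsto (fun n => ((p (φ n)).2 : E3)) atTop (𝓝 (k : E3)) :=
    (continuous_subtype_val.tendsto _).comp hk
  have hxR : x ∈ R := hR.1.1.mem_of_tendsto hx (Eventually.of_forall fun n => hp₁ _)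
  have hbx' : ⟪(b : E3), (x : E3)⟫ ≤ 0 := by
    refine le_of_tendsto_of_tendsto' (tendsto_const_nhds.inner hx') hεφ fun n => ?_
    have h1 := hp₂ (φ n)
    rw [inner_add_left, real_inner_smul_left] at h1
    have := mul_le_mul_of_nonneg_left (neg_one_le_inner_S2 v (p (φ n)).1) (hεpos (φ n)).le
    linarith
  have hxx : x = x₀ := eq_of_inner_eq_zero hR hb hxR hx₀ (le_antisymm hbx' (hb x hxR)) hbx
  subst hxx
  have hkA : ∃ d, IsDiametral R c k d :=
    (isClosed_isDiametral R c).mem_of_tendsto hk (Eventually.of_forall fun n => hp₃ _)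
  have hkR : k ∈ polar R := hkA.choose_spec.left_mem
  have hkx : ⟪(k : E3), (x : E3)⟫ = 0 :=
    tendsto_nhds_unique (hk'.inner hx') (by simp only [hp₄]; exact tendsto_const_nhds)
  have hxx : ∀ᶠ n in atTop, 0 < ⟪((p (φ n)).1 : E3), (x : E3)⟫ := by
    have : Tendsto (fun n => ⟪((p (φ n)).1 : E3), (x : E3)⟫) atTop (𝓝 1) := by
      have := hx'.inner (𝕜 := ℝ) (tendsto_const_nhds (x := (x : E3)))
      rwa [inner_self_S2] at this
    exact this.eventually (lt_mem_nhds one_pos)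
  -- Expand ⟪kₙ, xₙ⟫ = 0 in the basis `b`, `x₀`, `v`. The `x₀` term is nonnegative and the `b` term
  -- at least `-β`, while β < -εν with ν < 0; so ⟪kₙ, v⟫ < -ε would make the sum positive.
  have hkv : 0 ≤ ⟪(k : E3), (v : E3)⟫ := by
    have hlim' : Tendsto (fun n => -ε (φ n)) atTop (𝓝 0) := by simpa using hεφ.neg
    refine le_of_tendsto_of_tendsto hlim' (hk'.inner tendsto_const_nhds) ?_
    filter_upwards [hxx] with n hn
    obtain ⟨d, hd⟩ := hp₃ (φ n)
    have h1 := hd.left_mem x hxR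
    have h2 := hb _ (hp₁ (φ n))
    have h3 := hp₂ (φ n)
    have h4 := hp₄ (φ n)
    rw [hpars] at h4
    rw [inner_add_left, real_inner_smul_left] at h3
    rw [real_inner_comm] at h2
    rw [real_inner_comm ((p (φ n)).1 : E3) (b : E3),
      real_inner_comm ((p (φ n)).1 : E3) (v : E3)] at h3
    have h5 := mul_nonneg h1 hn.le
    have h6 := mul_le_mul_of_nonneg_right (neg_one_le_inner_S2 (p (φ n)).2 b) h2
    set β := ⟪((p (φ n)).1 : E3), (b : E3)⟫
    set ν := ⟪((p (φ n)).1 : E3), (v : E3)⟫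
    have h7 : ν < 0 := by
      by_contra h
      push Not at h
      have := mul_nonneg (hεpos (φ n)).le h
      linarith
    by_contra h8
    push Not at h8
    have h9 := mul_lt_mul_of_neg_right h8 h7
    linarith
  have hkv0 : ⟪(k : E3), (v : E3)⟫ = 0 := le_antisymm (hext k hkR hkx) hkv
  have hkb : k = b := by
    have h1 := hpars k k
    rw [hkx, hkv0, inner_self_S2] at h1
    rcases mul_self_eq_one_iff.1 (show ⟪(k : E3), (b : E3)⟫ * ⟪(k : E3), (b : E3)⟫ = 1 by linarith)
      with h2 | h2
    · exact eq_of_inner_S2_eq_one h2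
    · exact absurd (eq_neg_of_inner_S2_eq_neg_one h2 ▸ hkR) (neg_notMem_polar hR.1 hb)
  exact hkb ▸ hkA

/-! ### Diametral pairs of the polar cross -/

/-- The signs of the four coefficients decide which two arcs joining the four points cross. -/
theorem det3_relation (a b c d : E3) :
    det3 d c b • a + det3 b a d • c = det3 b a c • d + det3 d c a • b := by
  ext i; fin_cases i <;> simp [det3] <;> ring

theorem angle_eq_add_of_nonneg {a b p : E3} (hp : p ≠ 0) {s t : ℝ} (hs : 0 ≤ s) (ht : 0 ≤ t)
    (h : p = s • a + t • b) : InnerProductGeometry.angle a b =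
      InnerProductGeometry.angle a p + InnerProductGeometry.angle p b := by
  apply InnerProductGeometry.angle_eq_angle_add_add_angle_add_of_mem_span hp
  rw [Submodule.mem_span_pair]
  exact ⟨⟨s, hs⟩, ⟨t, ht⟩, h.symm⟩

/-- In a convex quadrilateral the diagonals `ab` and `de` are together at least as long as the
opposite sides `ae` and `db`. -/
theorem angle_add_angle_le_of_cross {a b d e : E3} {s t u v : ℝ} (hs : 0 ≤ s) (ht : 0 ≤ t)
    (hu : 0 ≤ u) (hv : 0 ≤ v) (hp : s • a + t • b ≠ 0) (h : s • a + t • b = u • d + v • e) :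
    InnerProductGeometry.angle a e + InnerProductGeometry.angle d b ≤
      InnerProductGeometry.angle a b + InnerProductGeometry.angle d e := by
  rw [angle_eq_add_of_nonneg hp hs ht rfl, angle_eq_add_of_nonneg hp hu hv h]
  have h1 := InnerProductGeometry.angle_le_angle_add_angle a (s • a + t • b) e
  have h2 := InnerProductGeometry.angle_le_angle_add_angle d (s • a + t • b) b
  linarith

theorem PolarDiameter.sdist_le {R : Set S2} {c s : ℝ} (hδ : PolarDiameter R c s) {k d : S2}
    (hk : k ∈ polar R) (hd : d ∈ polar R) : sdist k d ≤ Real.arccos (-c) := by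
  rw [sdist_eq_arccos]
  exact Real.arccos_le_arccos (hδ.le k hk d hd)

theorem PolarDiameter.isDiametral_of_le {R : Set S2} {c s : ℝ} (hδ : PolarDiameter R c s)
    {k d : S2} (hk : k ∈ polar R) (hd : d ∈ polar R) (h : Real.arccos (-c) ≤ sdist k d) :
    IsDiametral R c k d := by
  refine ⟨hk, hd, ?_⟩
  have h1 := le_antisymm (hδ.sdist_le hk hd) h
  rw [sdist_eq_arccos] at h1
  refine Real.arccos_injOn ⟨neg_one_le_inner_S2 _ _, inner_S2_le _ _⟩ ⟨?_, ?_⟩ h1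
  · nlinarith [hδ.sq_add_sq, hδ.c_pos, hδ.s_pos]
  · linarith [hδ.c_pos]

theorem IsDiametral.sdist_eq {R : Set S2} {c : ℝ} {k d : S2} (h : IsDiametral R c k d) :
    InnerProductGeometry.angle (k : E3) (d : E3) = Real.arccos (-c) := by
  rw [← h.inner_eq, ← sdist_eq_arccos]; rfl

theorem PolarDiameter.right_unique {R : Set S2} {c s : ℝ} (hδ : PolarDiameter R c s)
    (hR : IsStrictlyConvexBody R) {k d d' : S2} (h : IsDiametral R c k d)
    (h' : IsDiametral R c k d') : d = d' := by
  obtain ⟨x, hx, hkx, e⟩ := hδ.exists_normal hR.1 h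
  exact Subtype.ext (e.trans (hδ.right_eq hR h' hx hkx).symm)

theorem smul_add_smul_ne_zero_of_mem_polar {R : Set S2} (hR : IsConvexBody R) {a b : S2}
    (ha : a ∈ polar R) (hb : b ∈ polar R) {s t : ℝ} (hs : 0 < s) (ht : 0 ≤ t) :
    s • (a : E3) + t • (b : E3) ≠ 0 := by
  intro h0
  obtain ⟨z, hz⟩ := hR.2.2
  have h1 := inner_interior_pos (S2_ne_zero a) ha hz
  have h2 := hb z (interior_subset hz)
  have h3 : ⟪s • (a : E3) + t • (b : E3), (z : E3)⟫ = 0 := by rw [h0, inner_zero_left]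
  rw [inner_add_left, real_inner_smul_left, real_inner_smul_left] at h3
  have := mul_pos hs h1
  have := mul_nonneg ht h2
  linarith

theorem PolarDiameter.eq_or_eq_of_det3_pos {R : Set S2} {c s : ℝ} (hδ : PolarDiameter R c s)
    (hR : IsStrictlyConvexBody R) {k d k' d' : S2} (h : IsDiametral R c k d)
    (h' : IsDiametral R c k' d') (hd : 0 < det3 d' k' d) (hk : 0 < det3 d' k' k) :
    d = d' ∨ d = k' := by
  have hrel := det3_relation k d k' d'
  obtain ⟨x, hx, hkx, hdx⟩ := hδ.exists_normal hR.1 h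
  obtain ⟨y, hy, hdy, hky⟩ := hδ.exists_normal hR.1 h.symm
  have hky' : ⟪(k : E3), (y : E3)⟫ = s := by
    rw [hky, inner_sub_left, real_inner_smul_left, real_inner_smul_left, hdy, inner_self_S2]; ring
  have hdx' : ⟪(d : E3), (x : E3)⟫ = s := by
    rw [hdx, inner_sub_left, real_inner_smul_left, real_inner_smul_left, hkx, inner_self_S2]; ring
  have key : ∀ v : E3, det3 d' k' d * ⟪(k : E3), v⟫ + det3 d k d' * ⟪(k' : E3), v⟫ =
      det3 d k k' * ⟪(d' : E3), v⟫ + det3 d' k' k * ⟪(d : E3), v⟫ := by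
    intro v
    have := congrArg (fun w => ⟪w, v⟫) hrel
    simpa only [inner_add_left, real_inner_smul_left] using this
  set P := det3 d' k' d
  set Q := det3 d' k' k
  set P' := det3 d k d'
  set Q' := det3 d k k'
  have hs := hδ.s_pos
  -- Equal signs exhibit crossing diagonals, and the bound on their lengths makes one of them
  -- diametral. Mixed signs put `d` or `k` into the cone of the other three points, which is refuted
  -- at its own support point.
  rcases le_total 0 P' with hP' | hP' <;> rcases le_total 0 Q' with hQ' | hQ'
  · right
    have hle := angle_add_angle_le_of_cross hd.le hP' hQ' hk.le
      (smul_add_smul_ne_zero_of_mem_polar hR.1 h.left_mem h'.left_mem hd hP') hrel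
    rw [h.sdist_eq, h'.symm.sdist_eq] at hle
    have h1 : sdist d' d ≤ _ := hδ.sdist_le h'.right_mem h.right_mem
    have h2 : IsDiametral R c k k' := hδ.isDiametral_of_le h.left_mem h'.left_mem (by
      unfold sdist at h1 ⊢; linarith)
    exact hδ.right_unique hR h h2
  · exfalso
    have h1 := key y
    rw [hky', hdy] at h1
    have h2 := mul_pos hd hs
    have h3 := mul_nonneg hP' (h'.left_mem y hy)
    have h5 := mul_nonneg (neg_nonneg.2 hQ') (h'.right_mem y hy)
    linarith
  · exfalso
    have h1 := key x
    rw [hdx', hkx] at h1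
    have h2 := mul_pos hk hs
    have h3 := mul_nonneg (neg_nonneg.2 hP') (h'.left_mem x hx)
    have h5 := mul_nonneg hQ' (h'.right_mem x hx)
    linarith
  · left
    have hrel' : P • (k : E3) + (-Q') • (d' : E3) = (-P') • (k' : E3) + Q • (d : E3) := by
      rw [eq_sub_of_add_eq hrel]; module
    have hle := angle_add_angle_le_of_cross hd.le (neg_nonneg.2 hQ') (neg_nonneg.2 hP') hk.le
      (smul_add_smul_ne_zero_of_mem_polar hR.1 h.left_mem h'.right_mem hd (neg_nonneg.2 hQ')) hrel'
    rw [h.sdist_eq, h'.sdist_eq] at hle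
    have h1 : sdist k' d ≤ _ := hδ.sdist_le h'.left_mem h.right_mem
    have h2 : IsDiametral R c k d' := hδ.isDiametral_of_le h.left_mem h'.right_mem (by
      unfold sdist at h1 ⊢; linarith)
    exact hδ.right_unique hR h h2

/-- If both points of a diametral pair lie strictly on the same side of the great circle of another
diametral pair, then the pairs coincide. -/
theorem PolarDiameter.eq_or_eq_of_det3_mul_pos {R : Set S2} {c s : ℝ} (hδ : PolarDiameter R c s)
    (hR : IsStrictlyConvexBody R) {k d k' d' : S2} (h : IsDiametral R c k d)
    (h' : IsDiametral R c k' d') (hpos : 0 < det3 d' k' d * det3 d' k' k) :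
    d = d' ∨ d = k' := by
  rcases mul_pos_iff.1 hpos with ⟨h1, h2⟩ | ⟨h1, h2⟩
  · exact hδ.eq_or_eq_of_det3_pos hR h h' h1 h2
  · have e : ∀ w : E3, det3 k' d' w = -det3 d' k' w := fun w => by simp only [det3]; ring
    exact (hδ.eq_or_eq_of_det3_pos hR h h'.symm (by rw [e]; linarith) (by rw [e]; linarith)).symm

/-! ### Filling the gaps between diametral pairs -/

/-- Moving a vector of the bipolar cone away from a point of the body until it reaches the
boundary. -/
theorem exists_sub_smul_boundary {R : Set S2} (hR : IsConvexBody R) {x₀ : S2} (hx₀ : x₀ ∈ R)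
    {v : E3} (hv : ∀ d ∈ polar R, 0 ≤ ⟪(d : E3), v⟫) :
    ∃ t : ℝ, (∀ d ∈ polar R, 0 ≤ ⟪(d : E3), v - t • (x₀ : E3)⟫) ∧
      ∃ d ∈ polar R, ⟪(d : E3), v - t • (x₀ : E3)⟫ = 0 := by
  obtain ⟨g, hg⟩ := exists_inner_pos hR.1 hR.2.1
  have hg0 : g ≠ 0 := by
    rintro rfl
    simpa using hg x₀ hx₀
  set m := unit g hg0 with hm
  have hmR : m ∈ polar R := unit_mem_polar hg0 fun x hx => (hg x hx).le
  have hmx : 0 < ⟪(m : E3), (x₀ : E3)⟫ := by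
    rw [hm, inner_unit_left]
    exact mul_pos (inv_pos.2 (norm_pos_iff.2 hg0)) (hg x₀ hx₀)
  set S : Set ℝ := {t | ∀ d ∈ polar R, 0 ≤ ⟪(d : E3), v - t • (x₀ : E3)⟫} with hS
  have hSc : IsClosed S := by
    have : S = ⋂ d ∈ polar R, {t : ℝ | 0 ≤ ⟪(d : E3), v - t • (x₀ : E3)⟫} := by ext; simp [hS]
    rw [this]
    exact isClosed_biInter fun d _ => isClosed_le continuous_const (by fun_prop)
  have hSb : BddAbove S := by
    refine ⟨⟪(m : E3), v⟫ / ⟪(m : E3), (x₀ : E3)⟫, fun t ht => ?_⟩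
    have := ht m hmR
    rw [inner_sub_right, real_inner_smul_right] at this
    rw [le_div_iff₀ hmx]
    linarith
  have hSn : S.Nonempty := ⟨0, by simpa [hS] using hv⟩
  have hmem := hSc.csSup_mem hSn hSb
  set t := sSup S
  refine ⟨t, hmem, ?_⟩
  obtain ⟨d, hd, hmin⟩ := (isCompact_polar R).exists_isMinOn ⟨m, hmR⟩
    (f := fun d : S2 => ⟪(d : E3), v - t • (x₀ : E3)⟫) (by fun_prop)
  refine ⟨d, hd, le_antisymm ?_ (hmem d hd)⟩
  by_contra hpos
  push Not at hpos
  set μ := ⟪(d : E3), v - t • (x₀ : E3)⟫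
  -- A positive minimum `μ` would allow a further step of length `μ`, because no center has product
  -- above 1 with `x₀`.
  have : t + μ ∈ S := by
    intro e he
    have h1 : μ ≤ ⟪(e : E3), v - t • (x₀ : E3)⟫ := hmin he
    have h2 := mul_le_mul_of_nonneg_left (inner_S2_le e x₀) hpos.le
    rw [add_smul, ← sub_sub, inner_sub_right, real_inner_smul_right]
    linarith
  have := le_csSup hSb this
  linarith

/-- Position of a supporting center relative to a diametral great circle. -/
theorem PolarDiameter.det3_mul_det3_neg {R : Set S2} {c s : ℝ} (hδ : PolarDiameter R c s)
    {x₀ k₁ d₁ y₁ d y : S2} (h₁ : IsDiametral R c k₁ d₁)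
    (hk₁ : ⟪(k₁ : E3), (x₀ : E3)⟫ = 0) (hd₁ : (d₁ : E3) = s • (x₀ : E3) - c • (k₁ : E3))
    (hk₁y : (k₁ : E3) = s • (y₁ : E3) - c • (d₁ : E3)) (hy₁ : y₁ ∈ R) (hy : y ∈ R)
    (hd : d ∈ polar R) (hdy : ⟪(d : E3), (y : E3)⟫ = 0) (hdx : 0 < ⟪(d : E3), (x₀ : E3)⟫)
    (hd₁y : 0 < ⟪(d₁ : E3), (y : E3)⟫) : det3 x₀ k₁ d * det3 x₀ k₁ y < 0 := by
  have hs := hδ.s_pos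
  have hpars := inner_eq_of_orthonormal ((real_inner_comm _ _).trans hk₁) (d : E3) (y : E3)
  have e1 : ⟪(d₁ : E3), (y : E3)⟫ = s * ⟪(y : E3), (x₀ : E3)⟫ - c * ⟪(y : E3), (k₁ : E3)⟫ := by
    rw [hd₁, inner_sub_left, real_inner_smul_left, real_inner_smul_left,
      real_inner_comm (y : E3), real_inner_comm (y : E3)]
  have e2 : s * ⟪(d : E3), (y₁ : E3)⟫ =
      s ^ 2 * ⟪(d : E3), (k₁ : E3)⟫ + c * s * ⟪(d : E3), (x₀ : E3)⟫ := by
    have h1 : ⟪(d : E3), (k₁ : E3)⟫ = s * ⟪(d : E3), (y₁ : E3)⟫ - c * ⟪(d : E3), (d₁ : E3)⟫ := by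
      nth_rw 1 [hk₁y]
      rw [inner_sub_right, real_inner_smul_right, real_inner_smul_right]
    have h2 : ⟪(d : E3), (d₁ : E3)⟫ = s * ⟪(d : E3), (x₀ : E3)⟫ - c * ⟪(d : E3), (k₁ : E3)⟫ := by
      rw [hd₁, inner_sub_right, real_inner_smul_right, real_inner_smul_right]
    rw [h2] at h1
    have := hδ.sq_add_sq
    linear_combination (-1) * h1 + ⟪(d : E3), (k₁ : E3)⟫ * (-1) * this
  have e3 : ⟪(d : E3), (y₁ : E3)⟫ = s * ⟪(d : E3), (k₁ : E3)⟫ + c * ⟪(d : E3), (x₀ : E3)⟫ := by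
    apply mul_left_cancel₀ hs.ne'
    rw [e2]; ring
  have h1 := mul_pos hdx hd₁y
  have h2 := mul_nonneg (hd y₁ hy₁) (h₁.left_mem y hy)
  rw [e1] at h1
  rw [real_inner_comm (y : E3) (k₁ : E3), e3] at h2
  -- Substituting `e1` and `e3` into Parseval, the mixed terms cancel: `s` times the first two
  -- summands equals ⟪d, x₀⟫⟪d₁, y⟫ + ⟪d, y₁⟫⟪k₁, y⟫, which is positive.
  have h3 : s * (det3 x₀ k₁ d * det3 x₀ k₁ y) < 0 := by
    rw [hdy] at hpars
    nlinarith
  by_contra h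
  push Not at h
  have := mul_nonneg hs.le h
  linarith

/-- Between two centers of diametral pairs supporting the body at the same point there is a
third one. -/
theorem PolarDiameter.exists_between {R : Set S2} {c s : ℝ} (hδ : PolarDiameter R c s)
    (hR : IsStrictlyConvexBody R) (hred : IsReduced R) {x₀ k₁ k₂ d₁ d₂ : S2} (hx₀ : x₀ ∈ R)
    (h₁ : IsDiametral R c k₁ d₁) (h₂ : IsDiametral R c k₂ d₂)
    (hk₁ : ⟪(k₁ : E3), (x₀ : E3)⟫ = 0) (hk₂ : ⟪(k₂ : E3), (x₀ : E3)⟫ = 0)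
    (hdet : 0 < det3 x₀ k₁ k₂) :
    ∃ k d, IsDiametral R c k d ∧ ⟪(k : E3), (x₀ : E3)⟫ = 0 ∧ k ≠ k₁ ∧ k ≠ k₂ ∧
      0 ≤ det3 x₀ k₁ k ∧ 0 ≤ det3 x₀ k k₂ := by
  have hs := hδ.s_pos
  have hd₁ := hδ.right_eq hR h₁ hx₀ hk₁
  have hd₂ := hδ.right_eq hR h₂ hx₀ hk₂
  obtain ⟨y₁, hy₁, hdy₁, e₁⟩ := hδ.exists_normal hR.1 h₁.symm
  obtain ⟨y₂, hy₂, hdy₂, e₂⟩ := hδ.exists_normal hR.1 h₂.symm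
  have hdetd : ∀ a b w : S2, (b : E3) = s • (x₀ : E3) - c • (a : E3) →
      det3 b a w = s * det3 x₀ a w := by
    intro a b w h
    rw [h]; simp only [det3, PiLp.sub_apply, PiLp.smul_apply, smul_eq_mul]; ring
  -- Solving the two relations gives y' = s a + c x₀, so `y'` and `a` lie on the same side of every
  -- great circle through `x₀`.
  have hy' : ∀ a b y' w : S2, (b : E3) = s • (x₀ : E3) - c • (a : E3) →
      (a : E3) = s • (y' : E3) - c • (b : E3) → det3 x₀ w y' = s * det3 x₀ w a := by
    intro a b y' w h h'
    have h1 : s * det3 x₀ w y' = s ^ 2 * det3 x₀ w a := by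
      have h2 : det3 x₀ w a = s * det3 x₀ w y' - c * det3 x₀ w b := by
        nth_rw 1 [h']; simp only [det3, PiLp.sub_apply, PiLp.smul_apply, smul_eq_mul]; ring
      have h3 : det3 x₀ w b = - c * det3 x₀ w a := by
        rw [h]; simp only [det3, PiLp.sub_apply, PiLp.smul_apply, smul_eq_mul]; ring
      rw [h3] at h2
      linear_combination (-1) * h2 - det3 x₀ w a * hδ.sq_add_sq
    apply mul_left_cancel₀ hs.ne'
    rw [h1]; ring
  have hself : ∀ w : E3, det3 x₀ w w = 0 := fun w => by simp only [det3]; ring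
  -- Pushing `y₁ + y₂` away from `x₀` reaches the boundary between `y₁` and `y₂`; subtracting a
  -- multiple of `x₀` changes no determinant containing `x₀`.
  obtain ⟨t, ht, d₀, hd₀, hd₀t⟩ := exists_sub_smul_boundary hR.1 hx₀
    (v := (y₁ : E3) + (y₂ : E3)) (fun d hd => by
      rw [inner_add_right]; exact add_nonneg (hd _ hy₁) (hd _ hy₂))
  set w : E3 := (y₁ : E3) + (y₂ : E3) - t • (x₀ : E3) with hw
  have hdetw : ∀ u : E3, det3 x₀ u w = det3 x₀ u y₁ + det3 x₀ u y₂ := by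
    intro u
    rw [hw]; simp only [det3, PiLp.sub_apply, PiLp.add_apply, PiLp.smul_apply, smul_eq_mul]; ring
  have hw₁ : 0 < det3 x₀ k₁ w := by
    rw [hdetw, hy' k₁ d₁ y₁ k₁ hd₁ e₁, hy' k₂ d₂ y₂ k₁ hd₂ e₂, hself]
    have := mul_pos hs hdet
    linarith
  have hw₂ : det3 x₀ k₂ w < 0 := by
    rw [hdetw, hy' k₁ d₁ y₁ k₂ hd₁ e₁, hy' k₂ d₂ y₂ k₂ hd₂ e₂, hself, det3_swap]
    have := mul_pos hs hdet
    linarith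
  have hw0 : w ≠ 0 := by
    intro h
    rw [h] at hw₁
    simp [det3] at hw₁
  obtain ⟨r, hr, y, hy, hwy⟩ := mem_posCone_of_polar hR.1.1 hR.1.2.1 hw0 ht
  have hdety : ∀ u : E3, det3 x₀ u w = r * det3 x₀ u y := by
    intro u
    rw [hwy]; simp only [det3, PiLp.smul_apply, smul_eq_mul]; ring
  rw [hdety, mul_pos_iff_of_pos_left hr] at hw₁
  replace hw₂ : det3 x₀ k₂ y < 0 := by
    rw [hdety] at hw₂
    by_contra h
    push Not at h
    have := mul_nonneg hr.le h
    linarith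
  have hd₀y : ⟪(d₀ : E3), (y : E3)⟫ = 0 := by
    rw [hwy, real_inner_smul_right] at hd₀t
    exact (mul_eq_zero.1 hd₀t).resolve_left hr.ne'
  -- Here `d` supports at the new point `y`; its partner `k` is the center sought at `x₀`.
  obtain ⟨d, k, hdk, hdy⟩ := hδ.exists_isDiametral hR hred hy hd₀ hd₀y
  have hdx : 0 < ⟪(d : E3), (x₀ : E3)⟫ := by
    refine lt_of_le_of_ne (hdk.left_mem x₀ hx₀) fun h0 => ?_
    rw [eq_of_inner_eq_zero hR hdk.left_mem hy hx₀ hdy h0.symm] at hw₁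
    exact hw₁.ne' (by simp only [det3]; ring)
  have hd₁y : 0 < ⟪(d₁ : E3), (y : E3)⟫ := by
    refine lt_of_le_of_ne (h₁.right_mem y hy) fun h0 => ?_
    rw [eq_of_inner_eq_zero hR h₁.right_mem hy hy₁ h0.symm hdy₁, hy' k₁ d₁ y₁ k₁ hd₁ e₁, hself,
      mul_zero] at hw₁
    exact lt_irrefl _ hw₁
  have hd₂y : 0 < ⟪(d₂ : E3), (y : E3)⟫ := by
    refine lt_of_le_of_ne (h₂.right_mem y hy) fun h0 => ?_
    rw [eq_of_inner_eq_zero hR h₂.right_mem hy hy₂ h0.symm hdy₂, hy' k₂ d₂ y₂ k₂ hd₂ e₂, hself,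
      mul_zero] at hw₂
    exact lt_irrefl _ hw₂
  have hdet₁ : det3 x₀ k₁ d < 0 := by
    have := hδ.det3_mul_det3_neg h₁ hk₁ hd₁ e₁ hy₁ hy hdk.left_mem hdy hdx hd₁y
    by_contra h
    push Not at h
    have := mul_nonneg h hw₁.le
    linarith
  have hdet₂ : 0 < det3 x₀ k₂ d := by
    have := hδ.det3_mul_det3_neg h₂ hk₂ hd₂ e₂ hy₂ hy hdk.left_mem hdy hdx hd₂y
    by_contra h
    push Not at h
    have := mul_nonneg_of_nonpos_of_nonpos h hw₂.le
    linarith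
  -- The pair `d`, `k` must cross the pair `a`, `b`: a shared point is excluded since `b` is
  -- positive at `y` and `d` at `x₀`.
  have hcross : ∀ {a b : S2}, IsDiametral R c a b → ⟪(a : E3), (x₀ : E3)⟫ = 0 →
      0 < ⟪(b : E3), (y : E3)⟫ → (b : E3) = s • (x₀ : E3) - c • (a : E3) →
      det3 x₀ a d * det3 x₀ a k ≤ 0 := by
    intro a b hab hax hby hb
    by_contra h
    push Not at h
    rcases hδ.eq_or_eq_of_det3_mul_pos hR hdk.symm hab (by
      rw [hdetd a b d hb, hdetd a b k hb]
      have := mul_pos (mul_pos hs hs) h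
      linarith) with h1 | h1
    · rw [← h1, hdy] at hby; exact lt_irrefl _ hby
    · rw [h1, hax] at hdx; exact lt_irrefl _ hdx
  have hk₁' : 0 ≤ det3 x₀ k₁ k := by
    have := hcross h₁ hk₁ hd₁y hd₁
    by_contra h
    push Not at h
    have := mul_pos_of_neg_of_neg hdet₁ h
    linarith
  have hk₂' : 0 ≤ det3 x₀ k k₂ := by
    have := hcross h₂ hk₂ hd₂y hd₂
    rw [det3_swap]
    by_contra h
    push Not at h
    have := mul_pos hdet₂ (show 0 < det3 x₀ k₂ k by linarith)
    linarith
  obtain ⟨x, hx, hkx, hdx'⟩ := hδ.exists_normal hR.1 hdk.symm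
  have hxx : 0 < ⟪(x₀ : E3), (x : E3)⟫ := by
    have h1 := hdx
    rw [hdx', inner_sub_left, real_inner_smul_left, real_inner_smul_left, real_inner_comm] at h1
    have h2 := mul_nonneg hδ.c_pos.le (hdk.right_mem x₀ hx₀)
    have h3 : 0 < s * ⟪(x₀ : E3), (x : E3)⟫ := by linarith
    exact (mul_pos_iff_of_pos_left hs).1 h3
  have hcr := det3_cramer x₀ k₁ k₂ k
  have hcrv : ∀ v : E3, det3 x₀ k₁ k₂ * ⟪(k : E3), v⟫ = det3 k k₁ k₂ * ⟪(x₀ : E3), v⟫ +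
      det3 x₀ k k₂ * ⟪(k₁ : E3), v⟫ + det3 x₀ k₁ k * ⟪(k₂ : E3), v⟫ := by
    intro v
    have := congrArg (fun w => ⟪w, v⟫) hcr
    simpa only [inner_add_left, real_inner_smul_left] using this
  -- In Cramer's expansion of `k` in `x₀`, `k₁`, `k₂` all coefficients are nonnegative. At the
  -- support point `x` of `k` the sum vanishes while ⟪x₀, x⟫ > 0, so the `x₀` coefficient is zero.
  have hkx₀ : ⟪(k : E3), (x₀ : E3)⟫ = 0 := by
    have h1 := hcrv x₀
    rw [hk₁, hk₂, inner_self_S2] at h1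
    have h2 := hcrv x
    rw [hkx] at h2
    have h3 := hdk.right_mem x₀ hx₀
    have h4 := mul_nonneg hk₂' (h₁.left_mem x hx)
    have h5 := mul_nonneg hk₁' (h₂.left_mem x hx)
    have h6 : 0 ≤ det3 k k₁ k₂ := by
      have := mul_nonneg hdet.le h3
      linarith
    have h7 : det3 k k₁ k₂ = 0 := by
      have h8 := mul_nonneg h6 hxx.le
      have h9 : det3 k k₁ k₂ * ⟪(x₀ : E3), (x : E3)⟫ = 0 := by linarith
      exact (mul_eq_zero.1 h9).resolve_right hxx.ne'
    rw [h7] at h1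
    have h8 : det3 x₀ k₁ k₂ * ⟪(k : E3), (x₀ : E3)⟫ = 0 := by linarith
    exact (mul_eq_zero.1 h8).resolve_left hdet.ne'
  refine ⟨k, d, hdk.symm, hkx₀, ?_, ?_, hk₁', hk₂'⟩
  · rintro rfl
    rw [← hδ.right_unique hR hdk.symm h₁, hdy] at hd₁y
    exact lt_irrefl _ hd₁y
  · rintro rfl
    rw [← hδ.right_unique hR hdk.symm h₂, hdy] at hd₂y
    exact lt_irrefl _ hd₂y

/-! ### Diametrality of all supporting hemispheres and the width -/

theorem eq_of_det3_eq_zero {R : Set S2} (hR : IsConvexBody R) {x₀ k k' : S2}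
    (hk : k ∈ polar R) (hk' : k' ∈ polar R) (hkx : ⟪(k : E3), (x₀ : E3)⟫ = 0)
    (hkx' : ⟪(k' : E3), (x₀ : E3)⟫ = 0) (h : det3 x₀ k k' = 0) : k = k' := by
  have h1 := inner_eq_of_orthonormal ((real_inner_comm _ _).trans hkx) (k' : E3) (k' : E3)
  rw [hkx', h, inner_self_S2] at h1
  rcases mul_self_eq_one_iff.1
    (show ⟪(k' : E3), (k : E3)⟫ * ⟪(k' : E3), (k : E3)⟫ = 1 by linarith) with h2 | h2
  · exact (eq_of_inner_S2_eq_one h2).symm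
  · exact absurd (eq_neg_of_inner_S2_eq_neg_one h2 ▸ hk') (neg_notMem_polar hR hk)

/-- Every supporting hemisphere of a strictly convex reduced body belongs to a diametral pair. -/
theorem PolarDiameter.exists_isDiametral_of_supports {R : Set S2} {c s : ℝ}
    (hδ : PolarDiameter R c s) (hR : IsStrictlyConvexBody R) (hred : IsReduced R) {x₀ k₀ : S2}
    (hx₀ : x₀ ∈ R) (hk₀ : k₀ ∈ polar R) (hkx : ⟪(k₀ : E3), (x₀ : E3)⟫ = 0) :
    ∃ d, IsDiametral R c k₀ d := by
  by_contra hnot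
  obtain ⟨z, hz⟩ := hR.1.2.2
  have hpos : ∀ k ∈ polar R, 0 < ⟪(k : E3), (z : E3)⟫ :=
    fun k hk => inner_interior_pos (S2_ne_zero k) hk hz
  -- Dividing by ⟪k, z⟫ gives a projective coordinate on the arc `F` of centers supporting at `x₀`:
  -- its order agrees with the orientation `det3 x₀`, and `k₀` has coordinate 0.
  set σ : S2 → ℝ := fun k => det3 x₀ k₀ k / ⟪(k : E3), (z : E3)⟫ with hσ
  have hdetcont : Continuous fun k : S2 => det3 x₀ k₀ k := by unfold det3; fun_prop
  have hσcont : ContinuousOn σ (polar R) :=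
    ContinuousOn.div hdetcont.continuousOn (by fun_prop) fun k hk => (hpos k hk).ne'
  set F : Set S2 := {k | k ∈ polar R ∧ ⟪(k : E3), (x₀ : E3)⟫ = 0} with hF
  have hFc : IsClosed F := (isClosed_polar R).inter (isClosed_eq (by fun_prop) continuous_const)
  have hσF : ContinuousOn σ F := hσcont.mono fun k hk => hk.1
  have key : ∀ k ∈ F, ∀ k' ∈ F, det3 x₀ k k' * ⟪(k₀ : E3), (z : E3)⟫ =
      ⟪(k : E3), (z : E3)⟫ * ⟪(k' : E3), (z : E3)⟫ * (σ k' - σ k) := by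
    intro k hk k' hk'
    have hcrv : ∀ v : E3, det3 x₀ k k' * ⟪(k₀ : E3), v⟫ = det3 k₀ k k' * ⟪(x₀ : E3), v⟫ +
        det3 x₀ k₀ k' * ⟪(k : E3), v⟫ + det3 x₀ k k₀ * ⟪(k' : E3), v⟫ := by
      intro v
      have := congrArg (fun w => ⟪w, v⟫) (det3_cramer x₀ k k' k₀)
      simpa only [inner_add_left, real_inner_smul_left] using this
    have h0 : det3 k₀ k k' = 0 := by
      have := hcrv x₀
      rw [hkx, hk.2, hk'.2, inner_self_S2] at this
      linarith
    rw [hcrv, h0, det3_swap (x₀ : E3) (k₀ : E3) (k : E3), hσ]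
    have := (hpos k hk.1).ne'
    have := (hpos k' hk'.1).ne'
    field_simp
    ring
  have hle : ∀ k ∈ F, ∀ k' ∈ F, σ k ≤ σ k' → 0 ≤ det3 x₀ k k' := by
    intro k hk k' hk' h
    have h1 := key k hk k' hk'
    have h2 := mul_nonneg (mul_pos (hpos k hk.1) (hpos k' hk'.1)).le (sub_nonneg.2 h)
    rw [← h1] at h2
    exact nonneg_of_mul_nonneg_left h2 (hpos k₀ hk₀)
  have hlt : ∀ k ∈ F, ∀ k' ∈ F, σ k < σ k' → 0 < det3 x₀ k k' := by
    intro k hk k' hk' h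
    have h1 := key k hk k' hk'
    have h2 := mul_pos (mul_pos (hpos k hk.1) (hpos k' hk'.1)) (sub_pos.2 h)
    rw [← h1] at h2
    exact pos_of_mul_pos_left h2 (hpos k₀ hk₀).le
  have hle' : ∀ k ∈ F, ∀ k' ∈ F, 0 ≤ det3 x₀ k k' → σ k ≤ σ k' := by
    intro k hk k' hk' h
    by_contra hcon
    push Not at hcon
    have := hlt k' hk' k hk hcon
    rw [det3_swap] at this
    linarith
  have hinj : ∀ k ∈ F, ∀ k' ∈ F, σ k = σ k' → k = k' := by
    intro k hk k' hk' h
    refine eq_of_det3_eq_zero hR.1 hk.1 hk'.1 hk.2 hk'.2 (le_antisymm ?_ (hle k hk k' hk' h.le))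
    have := hle k' hk' k hk h.ge
    rw [det3_swap] at this
    linarith
  have hk₀F : k₀ ∈ F := ⟨hk₀, hkx⟩
  have hσ₀ : σ k₀ = 0 := by
    have : det3 x₀ k₀ k₀ = 0 := by simp only [det3]; ring
    simp [hσ, this]
  have hcyc : ∀ a k : E3, ⟪k, crossE a x₀⟫ = det3 x₀ k a := by
    intro a k
    rw [inner_crossE]; simp only [det3]; ring
  set A : Set S2 := {k | ∃ d, IsDiametral R c k d} with hA
  have hAc : IsClosed A := isClosed_isDiametral R c
  have hσA : ∀ k ∈ A ∩ F, σ k ≠ 0 := by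
    rintro k ⟨hk, hkF⟩ h
    rw [hinj k hkF k₀ hk₀F (h.trans hσ₀.symm)] at hk
    exact hnot hk
  obtain ⟨b, hb, hbmax⟩ := hFc.isCompact.exists_isMaxOn ⟨k₀, hk₀F⟩ hσF
  obtain ⟨a, ha, hamin⟩ := hFc.isCompact.exists_isMinOn ⟨k₀, hk₀F⟩ hσF
  have hbA : b ∈ A := by
    obtain ⟨v, hv⟩ := exists_cross hb.2
    refine hδ.exists_isDiametral_of_extreme hR hred hx₀ hb.1 hb.2 (v := -v)
      (Or.inr (by rw [← hv]; rfl)) fun k hk hkx' => ?_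
    have : ((-v : S2) : E3) = -(v : E3) := rfl
    rw [this, inner_neg_right, hv, hcyc]
    have := hle k ⟨hk, hkx'⟩ b hb (hbmax ⟨hk, hkx'⟩)
    linarith
  have haA : a ∈ A := by
    obtain ⟨v, hv⟩ := exists_cross ha.2
    refine hδ.exists_isDiametral_of_extreme hR hred hx₀ ha.1 ha.2 (v := v)
      (Or.inl hv) fun k hk hkx' => ?_
    rw [hv, hcyc]
    have := hle a ha k ⟨hk, hkx'⟩ (hamin ⟨hk, hkx'⟩)
    rw [det3_swap] at this
    linarith
  have hcl₁ : IsClosed (A ∩ F ∩ {k : S2 | det3 x₀ k₀ k ≤ 0}) :=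
    (hAc.inter hFc).inter (isClosed_le hdetcont continuous_const)
  have hcl₂ : IsClosed (A ∩ F ∩ {k : S2 | 0 ≤ det3 x₀ k₀ k}) :=
    (hAc.inter hFc).inter (isClosed_le continuous_const hdetcont)
  have hsign₁ : ∀ k ∈ F, σ k ≤ 0 → det3 x₀ k₀ k ≤ 0 := by
    intro k hk h
    have := hle k hk k₀ hk₀F (h.trans hσ₀.ge)
    rw [det3_swap] at this
    linarith
  have hsign₂ : ∀ k ∈ F, 0 ≤ σ k → 0 ≤ det3 x₀ k₀ k := fun k hk h =>
    hle k₀ hk₀F k hk (hσ₀.le.trans h)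
  -- `k₁` and `k₂` are the diametral centers on `F` nearest to `k₀` on either side; the endpoints
  -- `a` and `b` guarantee that they exist.
  obtain ⟨k₁, ⟨hk₁, hk₁s⟩, hmax⟩ := hcl₁.isCompact.exists_isMaxOn
    ⟨a, ⟨haA, ha⟩, hsign₁ a ha (hσ₀ ▸ hamin hk₀F)⟩ (hσF.mono fun k hk => hk.1.2)
  obtain ⟨k₂, ⟨hk₂, hk₂s⟩, hmin⟩ := hcl₂.isCompact.exists_isMinOn
    ⟨b, ⟨hbA, hb⟩, hsign₂ b hb (hσ₀ ▸ hbmax hk₀F)⟩ (hσF.mono fun k hk => hk.1.2)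
  have hneg : σ k₁ < 0 := by
    refine lt_of_le_of_ne ?_ (hσA k₁ hk₁)
    exact div_nonpos_of_nonpos_of_nonneg hk₁s (hpos k₁ hk₁.2.1).le
  have hpos₂ : 0 < σ k₂ := by
    refine lt_of_le_of_ne ?_ (hσA k₂ hk₂).symm
    exact div_nonneg hk₂s (hpos k₂ hk₂.2.1).le
  obtain ⟨d₁, h₁⟩ := hk₁.1
  obtain ⟨d₂, h₂⟩ := hk₂.1
  obtain ⟨k, d, hkd, hkx₀, hne₁, hne₂, hle₁, hle₂⟩ := hδ.exists_between hR hred hx₀ h₁ h₂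
    hk₁.2.2 hk₂.2.2 (hlt k₁ hk₁.2 k₂ hk₂.2 (hneg.trans hpos₂))
  have hkF : k ∈ F := ⟨hkd.left_mem, hkx₀⟩
  rcases le_total (σ k) 0 with h | h
  · have h3 : σ k ≤ σ k₁ := hmax ⟨⟨⟨d, hkd⟩, hkF⟩, hsign₁ k hkF h⟩
    exact hne₁ (hinj k hkF k₁ hk₁.2 (le_antisymm h3 (hle' k₁ hk₁.2 k hkF hle₁)))
  · have h3 : σ k₂ ≤ σ k := hmin ⟨⟨⟨d, hkd⟩, hkF⟩, hsign₂ k hkF h⟩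
    exact hne₂ (hinj k hkF k₂ hk₂.2 (le_antisymm (hle' k hkF k₂ hk₂.2 hle₂) h3))

/-- The polar of a body of thickness less than `π / 2` has diameter between `π / 2` and `π`. -/
theorem exists_polarDiameter {R : Set S2} (hR : IsConvexBody R)
    (hthick : thickness R < Real.pi / 2) : ∃ c s, PolarDiameter R c s := by
  obtain ⟨k, hk, k', hk', hmin, ht⟩ := exists_diameter hR
  have hneg : ⟪(k : E3), (k' : E3)⟫ < 0 := by
    by_contra h
    push Not at h
    have := Real.arccos_le_pi_div_two.2 h
    linarith
  have hgt : -1 < ⟪(k : E3), (k' : E3)⟫ := by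
    refine lt_of_le_of_ne (neg_one_le_inner_S2 _ _) fun h => ?_
    exact neg_notMem_polar hR hk' (eq_neg_of_inner_S2_eq_neg_one h.symm ▸ hk)
  have hsq : 0 < 1 - ⟪(k : E3), (k' : E3)⟫ ^ 2 := by nlinarith
  exact ⟨-⟪(k : E3), (k' : E3)⟫, √(1 - ⟪(k : E3), (k' : E3)⟫ ^ 2),
    fun d hd e he => by rw [neg_neg]; exact hmin d hd e he, by rw [neg_neg]; exact ht,
    by linarith, Real.sqrt_pos.2 hsq, by rw [Real.sq_sqrt hsq.le]; ring⟩

theorem PolarDiameter.width_eq {R : Set S2} {c s : ℝ} (hδ : PolarDiameter R c s)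
    (hR : IsStrictlyConvexBody R) (hred : IsReduced R) {k : S2} (hk : Supports k R) :
    width R k = Real.pi - Real.arccos (-c) := by
  obtain ⟨hkR, x, hx, hkx⟩ := (supports_iff hR.1.1).1 hk
  obtain ⟨d, hd⟩ := hδ.exists_isDiametral_of_supports hR hred hx hkR hkx
  rw [Spherical.width_eq hR.1 hkR hd.right_mem ?_ ?_, hd.inner_eq]
  · rintro rfl
    have := hd.inner_eq
    rw [inner_self_S2] at this
    linarith [hδ.c_pos]
  · intro e he
    rw [real_inner_comm, hd.inner_eq]
    exact hδ.le e he k hkR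

end Spherical

theorem theorem5 (R : Set Spherical.S2)
    (hstrict : Spherical.IsStrictlyConvexBody R)
    (hred : Spherical.IsReduced R)
    (hthick : Spherical.thickness R < Real.pi / 2) :
    Spherical.IsConstantWidth R := by
  obtain ⟨c, s, hδ⟩ := Spherical.exists_polarDiameter hstrict.1 hthick
  intro k k' hk hk'
  rw [hδ.width_eq hstrict hred hk, hδ.width_eq hstrict hred hk']
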